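/- For a finite connected graph $G$ with at least two vertices (simple, undirected; $|G|$ is the number of vertices and $\deg(G)$ the maximal degree), let $E=G\times\mathbb{Z}$ carry the product graph structure: $(g,u)\sim(g',u')$ iff either $g\sim g'$ and $u=u'$, or $g=g'$ and $|u-u'|=1$. For $x\in E$, let $P_x$ (with expectation $E_x$) be the law of the discrete-time simple random walk $(X_n)_{n\ge0}$ on $E$ started at $x$, which at each step jumps to a uniformly chosen neighbor of its current position. A finite set $S\subseteq E$ disconnects $E$ if, for all large $M$, $G\times[M,\infty)$ and $G\times(-\infty,-M]$ are contained in two distinct connected components of $E\setminus S$. Let $$\mathcal{T}_G=\inf\{n\ge0:\ \{X_0,\dots,X_n\}\text{ disconnects }E\},\qquad \mathcal{C}_G=\inf\{n\ge0:\ G\times\{0\}\subseteq\{X_0,\dots,X_n\}\}$$ be the disconnection time of $E$ and the cover time of $G\times\{0\}$. **Theorem.** Let $d_0$ be a nonnegative integer and $\varepsilon>0$. For every $\delta>0$ there is an integer $N$ (depending only on $d_0,\varepsilon,\delta$) such that for every finite connected graph $G$ with $\deg(G)\le d_0$ and $|G|\ge N$: 1. for every $x\in G\times\{0\}$, $\;P_x\big[\mathcal{T}_G\le\mathcal{C}_G\le|G|^2(\log|G|)^{4+\varepsilon}\big]\ge1-\delta$;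 2. for every $x\in E$, $\;P_x\big[\mathcal{T}_G\le|G|^2(\log|G|)^{4+\varepsilon}\big]\ge1-\delta$; 3. for every $x\in E$, $\;E_x[\mathcal{T}_G]\le\delta\,|G|^2(\log|G|)^{4+\varepsilon}$. In other words, as $|G|\to\infty$ over connected graphs with $\deg(G)\le d_0$, $$\inf_{x\in G\times\{0\}}P_x\big[\mathcal{T}_G\le\mathcal{C}_G\le|G|^2(\log|G|)^{4+\varepsilon}\big]\to1,\quad \inf_{x\in E}P_x\big[\mathcal{T}_G\le|G|^2(\log|G|)^{4+\varepsilon}\big]\to1,\quad \sup_{x\in E}\frac{E_x[\mathcal{T}_G]}{|G|^2(\log|G|)^{4+\varepsilon}}\to0.$$ -/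

import Mathlib

open MeasureTheory ProbabilityTheory Filter
open scoped ENNReal

namespace DiscreteCylinder

/-- The cylinder `G × ℤ` with its product graph structure: `(g, u)` and `(g', u')` are neighbors
iff either `g ∼ g'` and `u = u'`, or `g = g'` and `|u - u'| = 1`. -/
noncomputable def cylinderGraph {V : Type*} (G : SimpleGraph V) : SimpleGraph (V × ℤ) :=
  G.boxProd (SimpleGraph.hasse ℤ)

theorem cylinderGraph_neighborSet_finite {V : Type*} [Finite V] (G : SimpleGraph V) (x : V × ℤ) :
    ((cylinderGraph G).neighborSet x).Finite := by
  refine ((Set.finite_univ (α := V)).prod (Set.finite_Icc (x.2 - 1) (x.2 + 1))).subset ?_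
  rintro ⟨g, u⟩ h
  rw [SimpleGraph.mem_neighborSet, cylinderGraph, SimpleGraph.boxProd_adj] at h
  refine ⟨Set.mem_univ _, ?_⟩
  rcases h with ⟨-, h⟩ | ⟨h, -⟩
  · simp only at h
    simp only [Set.mem_Icc]
    omega
  · rw [SimpleGraph.hasse_adj, Order.covBy_iff_add_one_eq, Order.covBy_iff_add_one_eq] at h
    simp only [Set.mem_Icc] at h ⊢
    omega

theorem cylinderGraph_neighborSet_nonempty {V : Type*} (G : SimpleGraph V) (x : V × ℤ) :
    ((cylinderGraph G).neighborSet x).Nonempty := by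
  refine ⟨(x.1, x.2 + 1), ?_⟩
  rw [SimpleGraph.mem_neighborSet, cylinderGraph, SimpleGraph.boxProd_adj]
  right
  refine ⟨?_, rfl⟩
  rw [SimpleGraph.hasse_adj, Order.covBy_iff_add_one_eq]
  exact Or.inl rfl

/-- One step of the simple random walk on the cylinder: from `x`, jump to a uniformly chosen
neighbor of `x`. -/
noncomputable def stepKernel {V : Type*} [Finite V] [MeasurableSpace V] [DiscreteMeasurableSpace V]
    (G : SimpleGraph V) : Kernel (V × ℤ) (V × ℤ) where
  toFun x := uniformOn ((cylinderGraph G).neighborSet x)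
  measurable' := measurable_of_countable _

instance {V : Type*} [Finite V] [MeasurableSpace V] [DiscreteMeasurableSpace V]
    (G : SimpleGraph V) : IsMarkovKernel (stepKernel G) where
  isProbabilityMeasure x :=
    isProbabilityMeasure_uniformOn (cylinderGraph_neighborSet_finite G x)
      (cylinderGraph_neighborSet_nonempty G x)

/-- The canonical law `P_x`, on trajectories `ω : ℕ → V × ℤ`, of the discrete-time simple random
walk on the cylinder started at `x`. -/
noncomputable def walkLaw {V : Type*} [Finite V] [MeasurableSpace V] [DiscreteMeasurableSpace V]
    (G : SimpleGraph V) (x : V × ℤ) : Measure (ℕ → V × ℤ) :=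
  Kernel.trajMeasure (X := fun _ => V × ℤ) (Measure.dirac x)
    (fun n => (stepKernel G).comap (fun y => y ⟨n, Finset.mem_Iic.2 le_rfl⟩)
      (measurable_pi_apply _))

/-- `S` disconnects the cylinder: for all large `M`, the sets `G × [M, ∞)` and `G × (-∞, -M]` are
contained in two distinct connected components of the complement of `S`. -/
def Disconnects {V : Type*} (G : SimpleGraph V) (S : Set (V × ℤ)) : Prop :=
  ∀ᶠ M : ℤ in atTop, ∃ C₁ C₂ : ((cylinderGraph G).induce Sᶜ).ConnectedComponent,
    C₁ ≠ C₂ ∧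
    {x : V × ℤ | M ≤ x.2} ⊆ Subtype.val '' C₁.supp ∧
    {x : V × ℤ | x.2 ≤ -M} ⊆ Subtype.val '' C₂.supp

/-- The disconnection time: the first `n` such that `{ω 0, …, ω n}` disconnects the cylinder
(`⊤` if there is none). -/
noncomputable def disconnectionTime {V : Type*} (G : SimpleGraph V) (ω : ℕ → V × ℤ) : ℕ∞ :=
  ⨅ (n : ℕ) (_ : Disconnects G (ω '' Set.Iic n)), (n : ℕ∞)

/-- The cover time of the zero level: the first `n` such that `{ω 0, …, ω n}` contains `G × {0}`
(`⊤` if there is none). -/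
noncomputable def coverTime {V : Type*} (ω : ℕ → V × ℤ) : ℕ∞ :=
  ⨅ (n : ℕ) (_ : {x : V × ℤ | x.2 = 0} ⊆ ω '' Set.Iic n), (n : ℕ∞)

/-- The time scale `|G|² (log |G|)^(4+ε)`. -/
noncomputable def timeScale (V : Type*) [Fintype V] (ε : ℝ) : ℝ :=
  (Fintype.card V : ℝ) ^ 2 * Real.log (Fintype.card V) ^ (4 + ε)

end DiscreteCylinder

/-! A fully visited level separates the two ends, so it is enough to cover the starting level,
called level zero. Write n = |G|. Two estimates are played against each other. In time of order R²
the walk visits level zero at least l times, except with probability O(l/R)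
(`measure_few_visits_le`). A given point of level zero escapes l such visits with probability at
most 2(1 - 1/(2D))^l, where D = O(n log n) bounds the mean number of visits before that point is hit
(`measure_many_visits_not_hit_le`). With l of order D log n a union bound over the n points
succeeds. With R of order l the total time is of order n² (log n)⁴, and the factor (log n)^ε absorbs
all constants.

The heart is the bound D (`expVisits_zero_level_le`). Let f be the mean number of visits before
hitting (y, 0), up to a finite horizon, and m its average on level zero. Summation by parts bounds
the Dirichlet energy of f by (maximal degree + 2) n m, while `sq_sub_mean_le` gives (f(g, 0) - m)² ≤
O(log n) · energy. Since f vanishes at (y, 0), this reads m² ≤ B m with B = O(n log n); hence m ≤ B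
and f ≤ 2B.

The logarithm arises by moving up the cylinder and averaging f over a set that gains one adjacent
vertex per level. Replacing one average by the next costs O(√(energy / r)) when the set has r
elements; Cauchy–Schwarz turns this into a harmonic sum, and after n levels the set is all of G.

For the expectation, time is cut into blocks, in each of which the level occupied at its start fails
to be covered with conditional probability at most 1/2. -/

namespace DiscreteCylinder

/-! ### The walk: averaging operator, Markov property, supersolutions -/

section Walk

variable {V : Type*}

theorem cylinderGraph_adj_iff (G : SimpleGraph V) (x y : V × ℤ) :
    (cylinderGraph G).Adj x y ↔
      (G.Adj x.1 y.1 ∧ x.2 = y.2) ∨ (x.1 = y.1 ∧ (y.2 = x.2 + 1 ∨ y.2 = x.2 - 1)) := by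
  rw [cylinderGraph, SimpleGraph.boxProd_adj, SimpleGraph.hasse_adj, Order.covBy_iff_add_one_eq,
    Order.covBy_iff_add_one_eq]
  constructor
  · rintro (h | ⟨h, h'⟩)
    · exact Or.inl h
    · right; exact ⟨h', by omega⟩
  · rintro (h | ⟨h, h'⟩)
    · exact Or.inl h
    · right; exact ⟨by omega, h⟩

/-- The trajectory after time `τ`, translated so that it starts on level zero. -/
def recenter (τ : ℕ) (ω : ℕ → V × ℤ) : ℕ → V × ℤ :=
  fun s => ((ω (τ + s)).1, (ω (τ + s)).2 - (ω τ).2)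

theorem measurable_recenter [MeasurableSpace V] (τ : ℕ) : Measurable (recenter (V := V) τ) := by
  unfold recenter; fun_prop

variable [Fintype V]

/-- The averaging operator of the simple random walk on the cylinder. -/
noncomputable def stepOp (G : SimpleGraph V) [DecidableRel G.Adj] (f : V × ℤ → ℝ) (x : V × ℤ) : ℝ :=
  (∑ h ∈ G.neighborFinset x.1, f (h, x.2) + f (x.1, x.2 + 1) + f (x.1, x.2 - 1)) /
    (G.degree x.1 + 2)

theorem stepOp_mono (G : SimpleGraph V) [DecidableRel G.Adj] {f f' : V × ℤ → ℝ} {x : V × ℤ}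
    (hh : ∀ h, G.Adj x.1 h → f (h, x.2) ≤ f' (h, x.2))
    (hu : f (x.1, x.2 + 1) ≤ f' (x.1, x.2 + 1)) (hd : f (x.1, x.2 - 1) ≤ f' (x.1, x.2 - 1)) :
    stepOp G f x ≤ stepOp G f' x := by
  unfold stepOp
  have : ∑ h ∈ G.neighborFinset x.1, f (h, x.2) ≤ ∑ h ∈ G.neighborFinset x.1, f' (h, x.2) :=
    Finset.sum_le_sum fun h hm => hh h (by simpa using hm)
  gcongr

theorem stepOp_const (G : SimpleGraph V) [DecidableRel G.Adj] (c : ℝ) (x : V × ℤ) :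
    stepOp G (fun _ => c) x = c := by
  unfold stepOp
  rw [Finset.sum_const, SimpleGraph.card_neighborFinset_eq_degree, nsmul_eq_mul]
  have : (G.degree x.1 : ℝ) + 2 ≠ 0 := by positivity
  field_simp
  ring

theorem stepOp_nonneg (G : SimpleGraph V) [DecidableRel G.Adj] {f : V × ℤ → ℝ}
    (hf : ∀ x, 0 ≤ f x) (x : V × ℤ) : 0 ≤ stepOp G f x := by
  have := stepOp_mono G (f := fun _ => 0) (f' := f) (x := x) (fun h _ => hf _) (hf _) (hf _)
  rwa [stepOp_const] at this

theorem stepOp_le_of_le (G : SimpleGraph V) [DecidableRel G.Adj] {f : V × ℤ → ℝ} {c : ℝ}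
    (hf : ∀ x, f x ≤ c) (x : V × ℤ) : stepOp G f x ≤ c := by
  have := stepOp_mono G (f := f) (f' := fun _ => c) (x := x) (fun h _ => hf _) (hf _) (hf _)
  rwa [stepOp_const] at this

theorem stepOp_affine (G : SimpleGraph V) [DecidableRel G.Adj] (f : V × ℤ → ℝ) (a b : ℝ)
    (x : V × ℤ) : stepOp G (fun y => a + b * f y) x = a + b * stepOp G f x := by
  unfold stepOp
  rw [Finset.sum_add_distrib, Finset.sum_const, SimpleGraph.card_neighborFinset_eq_degree,
    nsmul_eq_mul, ← Finset.mul_sum]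
  have : (G.degree x.1 : ℝ) + 2 ≠ 0 := by positivity
  field_simp
  ring

variable [MeasurableSpace V] [DiscreteMeasurableSpace V]

theorem lintegral_stepKernel (G : SimpleGraph V) [DecidableRel G.Adj] (f : V × ℤ → ℝ≥0∞)
    (x : V × ℤ) :
    ∫⁻ y, f y ∂(stepKernel G x) = ((G.degree x.1 + 2 : ℕ) : ℝ≥0∞)⁻¹ *
      (∑ h ∈ G.neighborFinset x.1, f (h, x.2) + f (x.1, x.2 + 1) + f (x.1, x.2 - 1)) := by
  classical
  have hinj : Function.Injective fun h : V => (h, x.2) := fun a b h => (Prod.ext_iff.1 h).1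
  set N₀ : Finset (V × ℤ) := (G.neighborFinset x.1).image fun h => (h, x.2) with hN₀
  set N : Finset (V × ℤ) := insert (x.1, x.2 + 1) (insert (x.1, x.2 - 1) N₀) with hN
  have hset : (cylinderGraph G).neighborSet x = N := by
    ext ⟨g, u⟩
    simp only [SimpleGraph.mem_neighborSet, cylinderGraph_adj_iff, hN, hN₀, Finset.coe_insert,
      Set.mem_insert_iff, Prod.mk.injEq, Finset.coe_image,
      SimpleGraph.coe_neighborFinset, Set.mem_image]
    constructor
    · rintro (⟨h, h'⟩ | ⟨h, h' | h'⟩)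
      · exact Or.inr (Or.inr ⟨g, h, rfl, h'⟩)
      · exact Or.inl ⟨h.symm, h'⟩
      · exact Or.inr (Or.inl ⟨h.symm, h'⟩)
    · rintro (⟨h, h'⟩ | ⟨h, h'⟩ | ⟨a, h, h', h''⟩)
      · exact Or.inr ⟨h.symm, Or.inl h'⟩
      · exact Or.inr ⟨h.symm, Or.inr h'⟩
      · subst h'; exact Or.inl ⟨h, h''⟩
  have h1 : (x.1, x.2 - 1) ∉ N₀ := by
    simp only [hN₀, Finset.mem_image, Prod.mk.injEq, not_exists, not_and]
    intros
    omega
  have h2 : (x.1, x.2 + 1) ∉ insert (x.1, x.2 - 1) N₀ := by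
    simp only [Finset.mem_insert, Prod.mk.injEq, hN₀, Finset.mem_image, not_or, not_exists, not_and]
    exact ⟨by omega, by intros; omega⟩
  have hcard : N.card = G.degree x.1 + 2 := by
    rw [hN, Finset.card_insert_of_notMem h2, Finset.card_insert_of_notMem h1, hN₀,
      Finset.card_image_of_injective _ hinj, SimpleGraph.card_neighborFinset_eq_degree]
  have hsum : ∑ y ∈ N, f y =
      ∑ h ∈ G.neighborFinset x.1, f (h, x.2) + f (x.1, x.2 + 1) + f (x.1, x.2 - 1) := by
    rw [hN, Finset.sum_insert h2, Finset.sum_insert h1, hN₀, Finset.sum_image hinj.injOn]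
    ring
  change ∫⁻ y, f y ∂(uniformOn ((cylinderGraph G).neighborSet x)) = _
  rw [hset, uniformOn, ProbabilityTheory.cond, lintegral_smul_measure, lintegral_finset,
    Measure.count_apply_finset, hcard, smul_eq_mul, ← hsum]
  congr 1
  exact Finset.sum_congr rfl fun y _ => by rw [Measure.count_singleton, mul_one]

theorem lintegral_ofReal_stepKernel (G : SimpleGraph V) [DecidableRel G.Adj] {f : V × ℤ → ℝ}
    (hf : ∀ x, 0 ≤ f x) (x : V × ℤ) :
    ∫⁻ y, ENNReal.ofReal (f y) ∂(stepKernel G x) = ENNReal.ofReal (stepOp G f x) := by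
  have hs : 0 ≤ ∑ h ∈ G.neighborFinset x.1, f (h, x.2) := Finset.sum_nonneg fun _ _ => hf _
  have hd : ((G.degree x.1 : ℝ) + 2) = ((G.degree x.1 + 2 : ℕ) : ℝ) := by push_cast; ring
  rw [lintegral_stepKernel, ← ENNReal.ofReal_sum_of_nonneg fun y _ => hf _,
    ← ENNReal.ofReal_add hs (hf _), ← ENNReal.ofReal_add (by have := hf (x.1, x.2 + 1); positivity)
    (hf _), stepOp, hd, div_eq_inv_mul, ENNReal.ofReal_mul (by positivity),
    ENNReal.ofReal_inv_of_pos (by positivity), ENNReal.ofReal_natCast]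

theorem stepKernel_translate (G : SimpleGraph V) (x : V × ℤ) (k : ℤ) (f : V × ℤ → ℝ≥0∞) :
    ∫⁻ y, f (y.1, y.2 - k) ∂(stepKernel G x) = ∫⁻ y, f y ∂(stepKernel G (x.1, x.2 - k)) := by
  classical
  rw [lintegral_stepKernel, lintegral_stepKernel]
  simp only [sub_right_comm, add_sub_right_comm]

/-- A measure on trajectories has the (forward) Markov property of the simple random walk on the
cylinder, with an arbitrary initial measure. -/
def IsWalk (G : SimpleGraph V) (μ : Measure (ℕ → V × ℤ)) : Prop :=
  ∀ (t : ℕ) (Ψ : (Finset.Iic t → V × ℤ) → V × ℤ → ℝ≥0∞),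
    ∫⁻ ω, Ψ (Preorder.frestrictLe (π := fun _ => V × ℤ) t ω) (ω (t + 1)) ∂μ =
      ∫⁻ ω, ∫⁻ x, Ψ (Preorder.frestrictLe (π := fun _ => V × ℤ) t ω) x ∂(stepKernel G (ω t)) ∂μ

instance (G : SimpleGraph V) (x : V × ℤ) : IsProbabilityMeasure (walkLaw G x) := by
  unfold walkLaw; infer_instance

theorem isWalk_walkLaw (G : SimpleGraph V) (x : V × ℤ) : IsWalk G (walkLaw G x) := by
  intro t Ψ
  have key := Kernel.map_frestrictLe_trajMeasure_compProd_eq_map_trajMeasure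
    (X := fun _ => V × ℤ) (μ₀ := Measure.dirac x)
    (κ := fun n => (stepKernel G).comap (fun y => y ⟨n, Finset.mem_Iic.2 le_rfl⟩)
      (measurable_pi_apply _)) (a := t)
  have hm : Measurable (Function.uncurry Ψ) := measurable_of_countable _
  have h1 := congrArg (fun ν => ∫⁻ p, Function.uncurry Ψ p ∂ν) key
  rw [Measure.lintegral_compProd hm, lintegral_map hm (by fun_prop),
    lintegral_map (measurable_of_countable _) (by fun_prop)] at h1
  exact h1.symm

theorem walkLaw_ae_zero (G : SimpleGraph V) (x : V × ℤ) : ∀ᵐ ω ∂(walkLaw G x), ω 0 = x := by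
  have h := Kernel.traj_map_frestrictLe_of_le (X := fun _ => V × ℤ)
    (κ := fun n => (stepKernel G).comap (fun y => y ⟨n, Finset.mem_Iic.2 le_rfl⟩)
      (measurable_pi_apply _)) (le_refl 0)
  set e := (MeasurableEquiv.piUnique (fun _ : Finset.Iic 0 => V × ℤ)).symm
  rw [walkLaw, Kernel.trajMeasure, Measure.map_dirac' e.measurable x,
    Measure.dirac_bind (Kernel.measurable _)]
  have h2 := congrArg (fun κ => κ (e x)) h
  simp only [Kernel.deterministic_apply] at h2
  rw [Kernel.map_apply _ (by fun_prop)] at h2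
  have h3 : ∀ᵐ w ∂(Measure.map (Preorder.frestrictLe (π := fun _ => V × ℤ) 0)
      (Kernel.traj (X := fun _ => V × ℤ) (fun n => (stepKernel G).comap
        (fun y => y ⟨n, Finset.mem_Iic.2 le_rfl⟩) (measurable_pi_apply _)) 0 (e x))),
      w ⟨0, by simp⟩ = x := by
    rw [h2, ae_dirac_iff (measurableSet_eq_fun (measurable_pi_apply _) measurable_const)]
    rfl
  exact ae_of_ae_map (by fun_prop) h3

/-- The simple Markov property: conditioning on the past does not affect later steps, and the step
kernel commutes with vertical translations. Since the restricted measure may have mass below one,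
later bounds carry the factor `μ Set.univ`. -/
theorem IsWalk.map_recenter {G : SimpleGraph V} {μ : Measure (ℕ → V × ℤ)} (hμ : IsWalk G μ)
    (τ : ℕ) (B : Set (Finset.Iic τ → V × ℤ)) :
    IsWalk G ((μ.restrict (Preorder.frestrictLe (π := fun _ => V × ℤ) τ ⁻¹' B)).map
      (recenter τ)) := by
  classical
  intro t Ψ
  have hB : MeasurableSet (Preorder.frestrictLe (π := fun _ => V × ℤ) τ ⁻¹' B) :=
    (Set.to_countable B).measurableSet.preimage (by fun_prop)
  have hτ : τ ∈ Finset.Iic (τ + t) := by simp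
  let past : (Finset.Iic (τ + t) → V × ℤ) → (Finset.Iic τ → V × ℤ) :=
    fun w i => w ⟨i, Finset.mem_Iic.2 ((Finset.mem_Iic.1 i.2).trans (Nat.le_add_right _ _))⟩
  let fut : (Finset.Iic (τ + t) → V × ℤ) → (Finset.Iic t → V × ℤ) :=
    fun w i => ((w ⟨τ + i, Finset.mem_Iic.2 (Nat.add_le_add_left (Finset.mem_Iic.1 i.2) _)⟩).1,
      (w ⟨τ + i, Finset.mem_Iic.2 (Nat.add_le_add_left (Finset.mem_Iic.1 i.2) _)⟩).2 -
        (w ⟨τ, hτ⟩).2)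
  have key := hμ (τ + t) (fun w x => if past w ∈ B then
    Ψ (fut w) (x.1, x.2 - (w ⟨τ, hτ⟩).2) else 0)
  have hr : ∀ s, Measurable fun ω : ℕ → V × ℤ => Preorder.frestrictLe (π := fun _ => V × ℤ) s ω :=
    fun s => by fun_prop
  have hΨ : Measurable (Function.uncurry Ψ) := measurable_of_countable _
  have hΦ : Measurable (fun p : (Finset.Iic t → V × ℤ) × (V × ℤ) =>
      ∫⁻ x, Ψ p.1 x ∂(stepKernel G p.2)) := measurable_of_countable _
  have hm1 : Measurable fun ω : ℕ → V × ℤ =>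
      Ψ (Preorder.frestrictLe (π := fun _ => V × ℤ) t ω) (ω (t + 1)) :=
    hΨ.comp ((hr t).prodMk (measurable_pi_apply (t + 1)))
  have hm2 : Measurable fun ω : ℕ → V × ℤ =>
      ∫⁻ x, Ψ (Preorder.frestrictLe (π := fun _ => V × ℤ) t ω) x ∂(stepKernel G (ω t)) := by
    have hp : Measurable fun ω : ℕ → V × ℤ =>
        (Preorder.frestrictLe (π := fun _ => V × ℤ) t ω, ω t) :=
      (hr t).prodMk (measurable_pi_apply t)
    have h := hΦ.comp hp
    exact h
  have hpt : ∀ ω : ℕ → V × ℤ, (Preorder.frestrictLe (π := fun _ => V × ℤ) τ ⁻¹' B).indicator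
      (fun ω => ∫⁻ x, Ψ (Preorder.frestrictLe (π := fun _ => V × ℤ) t (recenter τ ω)) x
        ∂(stepKernel G (recenter τ ω t))) ω =
      ∫⁻ x, (if past (Preorder.frestrictLe (π := fun _ => V × ℤ) (τ + t) ω) ∈ B then
        Ψ (fut (Preorder.frestrictLe (π := fun _ => V × ℤ) (τ + t) ω)) (x.1, x.2 - (ω τ).2) else 0)
        ∂(stepKernel G (ω (τ + t))) := by
    intro ω
    have hpast : past (Preorder.frestrictLe (π := fun _ => V × ℤ) (τ + t) ω) =
      Preorder.frestrictLe (π := fun _ => V × ℤ) τ ω := rfl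
    have hfut : fut (Preorder.frestrictLe (π := fun _ => V × ℤ) (τ + t) ω) =
      Preorder.frestrictLe (π := fun _ => V × ℤ) t (recenter τ ω) := rfl
    rw [hpast, hfut]
    by_cases h : Preorder.frestrictLe (π := fun _ => V × ℤ) τ ω ∈ B
    · rw [Set.indicator_of_mem (show ω ∈ Preorder.frestrictLe (π := fun _ => V × ℤ) τ ⁻¹' B from h)]
      simp only [if_pos h]
      exact (stepKernel_translate G (ω (τ + t)) (ω τ).2
        (Ψ (Preorder.frestrictLe (π := fun _ => V × ℤ) t (recenter τ ω)))).symm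
    · rw [Set.indicator_of_notMem (show ω ∉ Preorder.frestrictLe (π := fun _ => V × ℤ) τ ⁻¹' B from h)]
      simp only [if_neg h, lintegral_zero]
  rw [lintegral_map hm1 (measurable_recenter τ), lintegral_map hm2 (measurable_recenter τ),
    ← lintegral_indicator hB, ← lintegral_indicator hB]
  exact key.trans (lintegral_congr fun ω => (hpt ω).symm)

/-- Feynman–Kac bound: f evaluated along the walk, times the accumulated weights, is a
supermartingale. It does the work of stopping times in both hitting estimates. -/
theorem IsWalk.lintegral_prod_le {G : SimpleGraph V} [DecidableRel G.Adj]
    {μ : Measure (ℕ → V × ℤ)} (hμ : IsWalk G μ)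
    {c : V × ℤ → ℝ} {f : ℕ → V × ℤ → ℝ} (hc : ∀ x, 0 ≤ c x) (hf : ∀ s x, 0 ≤ f s x) (t : ℕ)
    (h : ∀ s < t, ∀ x, c x * stepOp G (f (s + 1)) x ≤ f s x) :
    ∫⁻ ω, (∏ s ∈ Finset.range t, ENNReal.ofReal (c (ω s))) * ENNReal.ofReal (f t (ω t)) ∂μ ≤
      ∫⁻ ω, ENNReal.ofReal (f 0 (ω 0)) ∂μ := by
  induction t with
  | zero => simp
  | succ t ih =>
    refine le_trans ?_ (ih fun s hs => h s (by omega))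
    have := hμ t (fun w x => (∏ s : Finset.Iic t, ENNReal.ofReal (c (w s))) *
      ENNReal.ofReal (f (t + 1) x))
    have hprod : ∀ ω : ℕ → V × ℤ, (∏ s : Finset.Iic t, ENNReal.ofReal (c
        (Preorder.frestrictLe (π := fun _ => V × ℤ) t ω s))) =
        ∏ s ∈ Finset.range (t + 1), ENNReal.ofReal (c (ω s)) := by
      intro ω
      rw [show Finset.range (t + 1) = Finset.Iic t by ext; simp]
      exact Finset.prod_coe_sort (Finset.Iic t) (fun s => ENNReal.ofReal (c (ω s)))
    simp only [hprod] at this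
    rw [this]
    refine lintegral_mono fun ω => ?_
    rw [lintegral_const_mul _ (measurable_of_countable _), lintegral_ofReal_stepKernel G (hf _),
      Finset.prod_range_succ, mul_assoc, ← ENNReal.ofReal_mul (hc _)]
    gcongr
    exact h t (by omega) _

end Walk

/-! ### Dirichlet energy and deviation from the mean -/

section Energy

variable {V : Type*}

/-- Twice the Dirichlet energy of `F` on the subgraph induced by `A`. -/
noncomputable def energyOn (G : SimpleGraph V) [DecidableRel G.Adj] (A : Finset V) (F : V → ℝ) :
    ℝ :=
  ∑ a ∈ A, ∑ b ∈ A, if G.Adj a b then (F a - F b) ^ 2 else 0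

theorem energyOn_term_nonneg (G : SimpleGraph V) [DecidableRel G.Adj] (F : V → ℝ) (a b : V) :
    0 ≤ if G.Adj a b then (F a - F b) ^ 2 else 0 := by
  split_ifs <;> positivity

/-- The average of `F` over `A`. -/
noncomputable def mean (A : Finset V) (F : V → ℝ) : ℝ := (∑ a ∈ A, F a) / A.card

theorem mean_sub (A : Finset V) (F F' : V → ℝ) :
    mean A F - mean A F' = mean A (fun a => F a - F' a) := by
  unfold mean
  rw [Finset.sum_sub_distrib, sub_div]

theorem energyOn_nonneg (G : SimpleGraph V) [DecidableRel G.Adj] (A : Finset V) (F : V → ℝ) :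
    0 ≤ energyOn G A F :=
  Finset.sum_nonneg fun _ _ => Finset.sum_nonneg fun _ _ => energyOn_term_nonneg G F _ _

theorem energyOn_mono (G : SimpleGraph V) [DecidableRel G.Adj] {A B : Finset V} (h : A ⊆ B)
    (F : V → ℝ) : energyOn G A F ≤ energyOn G B F := by
  unfold energyOn
  refine le_trans (Finset.sum_le_sum fun a _ => Finset.sum_le_sum_of_subset_of_nonneg h
    fun b _ _ => energyOn_term_nonneg G F _ _) ?_
  exact Finset.sum_le_sum_of_subset_of_nonneg h fun b _ _ =>
    Finset.sum_nonneg fun _ _ => energyOn_term_nonneg G F _ _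

theorem energyOn_insert_ge (G : SimpleGraph V) [DecidableRel G.Adj] [DecidableEq V]
    {A : Finset V} {a b : V} (ha : a ∈ A) (hb : b ∉ A) (hab : G.Adj a b) (F : V → ℝ) :
    energyOn G A F + (F b - F a) ^ 2 ≤ energyOn G (insert b A) F := by
  unfold energyOn
  rw [Finset.sum_insert hb]
  have h1 : (F b - F a) ^ 2 ≤ ∑ c ∈ insert b A, if G.Adj b c then (F b - F c) ^ 2 else 0 := by
    have := Finset.single_le_sum (s := insert b A)
      (f := fun c => if G.Adj b c then (F b - F c) ^ 2 else 0)
      (fun c _ => energyOn_term_nonneg G F b c) (Finset.mem_insert_of_mem ha)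
    simpa [hab.symm] using this
  have h2 : ∑ x ∈ A, ∑ c ∈ A, (if G.Adj x c then (F x - F c) ^ 2 else 0) ≤
      ∑ x ∈ A, ∑ c ∈ insert b A, if G.Adj x c then (F x - F c) ^ 2 else 0 :=
    Finset.sum_le_sum fun a _ => Finset.sum_le_sum_of_subset_of_nonneg (Finset.subset_insert _ _)
      fun b _ _ => energyOn_term_nonneg G F _ _
  linarith

/-- Squared oscillations on `A` are controlled by the energy on `A` times the cardinality. -/
def OscBound (G : SimpleGraph V) [DecidableRel G.Adj] (A : Finset V) : Prop :=
  ∀ F : V → ℝ, ∀ a ∈ A, ∀ b ∈ A, (F a - F b) ^ 2 ≤ A.card * energyOn G A F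

variable [Fintype V]

/-- Add the outer endpoint of an edge leaving A. With increment p along this edge, q inside A and s
= |A|, weighted Cauchy–Schwarz gives (p + q)² ≤ (s + 1)(p² + q²/s), and q²/s is at most the old
energy. -/
theorem exists_oscBound_insert {G : SimpleGraph V} [DecidableRel G.Adj] [DecidableEq V]
    (hG : G.Connected) {A : Finset V} (hA : A.Nonempty) (hne : A.card < Fintype.card V)
    (hosc : OscBound G A) : ∃ b ∉ A, OscBound G (insert b A) := by
  obtain ⟨a, ha⟩ := hA
  obtain ⟨v, hv⟩ : ∃ v, v ∉ A := by
    by_contra! h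
    rw [Finset.eq_univ_iff_forall.2 h, Finset.card_univ] at hne
    exact lt_irrefl _ hne
  obtain ⟨p⟩ := hG.preconnected a v
  obtain ⟨d, -, hd1, hd2⟩ := p.exists_boundary_dart (A : Set V) ha hv
  have hd1 : d.fst ∈ A := hd1
  have hd2 : d.snd ∉ A := hd2
  refine ⟨d.snd, hd2, fun F => ?_⟩
  have hE := energyOn_insert_ge G hd1 hd2 d.adj F
  have h0 := energyOn_nonneg G A F
  have hcard : ((insert d.snd A).card : ℝ) = A.card + 1 := by
    rw [Finset.card_insert_of_notMem hd2]; push_cast; ring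
  have hc0 : (0 : ℝ) < A.card := by exact_mod_cast Finset.card_pos.2 ⟨_, hd1⟩
  have hnew : ∀ c ∈ A, (F d.snd - F c) ^ 2 ≤
      (A.card + 1) * energyOn G (insert d.snd A) F := by
    intro c hc
    have h := hosc F d.fst hd1 c hc
    set s : ℝ := (A.card : ℝ)
    set p := F d.snd - F d.fst
    set q := F d.fst - F c
    have hpq : F d.snd - F c = p + q := by simp only [p, q]; ring
    have h1 : (p + q) ^ 2 ≤ (s + 1) * (p ^ 2 + q ^ 2 / s) := by
      have : (s + 1) * (p ^ 2 + q ^ 2 / s) - (p + q) ^ 2 = (s * p - q) ^ 2 / s := by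
        field_simp; ring
      have h' : 0 ≤ (s * p - q) ^ 2 / s := by positivity
      linarith
    have h2 : q ^ 2 / s ≤ energyOn G A F := by
      rw [div_le_iff₀ hc0]; linarith
    rw [hpq]
    refine h1.trans ?_
    gcongr
    linarith
  have hnn := energyOn_nonneg G (insert d.snd A) F
  intro x hx y hy
  rw [hcard]
  rw [Finset.mem_insert] at hx hy
  rcases hx with rfl | hx <;> rcases hy with rfl | hy
  · rw [sub_self, zero_pow two_ne_zero]; positivity
  · exact hnew y hy
  · rw [← neg_sub, neg_sq]; exact hnew x hx
  · refine (hosc F x hx y hy).trans ?_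
    have hp : 0 ≤ (F d.snd - F d.fst) ^ 2 := sq_nonneg _
    gcongr <;> linarith

theorem sq_mean_le (A : Finset V) (F : V → ℝ) : mean A F ^ 2 ≤ (∑ a, F a ^ 2) / A.card := by
  unfold mean
  rcases A.eq_empty_or_nonempty with rfl | hA
  · simp
  have hc0 : (0 : ℝ) < A.card := by exact_mod_cast Finset.card_pos.2 hA
  have h1 := sq_sum_le_card_mul_sum_sq (s := A) (f := F)
  have h2 : ∑ a ∈ A, F a ^ 2 ≤ ∑ a, F a ^ 2 :=
    Finset.sum_le_sum_of_subset_of_nonneg (Finset.subset_univ _) fun _ _ _ => sq_nonneg _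
  rw [div_pow, div_le_div_iff₀ (by positivity) hc0]
  nlinarith

/-- The mean moves by the average of F a - F b divided by |A| + 1, and each squared difference is at
most (|A| + 1) times the energy. -/
theorem sq_mean_sub_mean_insert_le {G : SimpleGraph V} [DecidableRel G.Adj] [DecidableEq V]
    {A : Finset V} (hA : A.Nonempty) {b : V} (hb : b ∉ A) (hosc : OscBound G (insert b A))
    (F : V → ℝ) :
    (mean A F - mean (insert b A) F) ^ 2 ≤ energyOn G Finset.univ F / A.card := by
  have hm : (0 : ℝ) < A.card := by exact_mod_cast Finset.card_pos.2 hA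
  have hE := energyOn_mono G (Finset.subset_univ (insert b A)) F
  set E := energyOn G Finset.univ F
  have hcard : ((insert b A).card : ℝ) = A.card + 1 := by
    rw [Finset.card_insert_of_notMem hb]; push_cast; ring
  have heq : mean A F - mean (insert b A) F =
      (∑ a ∈ A, (F a - F b)) / (A.card * (A.card + 1)) := by
    unfold mean
    rw [hcard, Finset.sum_insert hb, Finset.sum_sub_distrib, Finset.sum_const, nsmul_eq_mul]
    field_simp
    ring
  have h1 := sq_sum_le_card_mul_sum_sq (s := A) (f := fun a => F a - F b)
  have h2 : ∑ a ∈ A, (F a - F b) ^ 2 ≤ A.card * ((A.card + 1) * E) := by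
    rw [← nsmul_eq_mul, ← Finset.sum_const]
    refine Finset.sum_le_sum fun a ha => ?_
    refine (hosc F a (Finset.mem_insert_of_mem ha) b (Finset.mem_insert_self _ _)).trans ?_
    rw [hcard]
    gcongr
  have hE0 : 0 ≤ E := energyOn_nonneg _ _ _
  rw [heq, div_pow, div_le_div_iff₀ (by positivity) hm]
  calc _ ≤ ((A.card : ℝ) * (A.card * ((A.card + 1) * E))) * A.card := by gcongr; nlinarith
    _ ≤ _ := by
      have : 0 ≤ E * (A.card : ℝ) ^ 3 * (A.card + 1) := by positivity
      nlinarith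

/-- The energy of the edges between two consecutive levels. -/
noncomputable def verticalEnergy (F F' : V → ℝ) : ℝ := ∑ a, (F a - F' a) ^ 2

theorem verticalEnergy_nonneg (F F' : V → ℝ) : 0 ≤ verticalEnergy F F' :=
  Finset.sum_nonneg fun _ _ => sq_nonneg _

/-- Each step first lifts the average over A by one level, at the cost of vertical energy, and then
enlarges A by one vertex, at the cost of horizontal energy on the new level. -/
theorem exists_oscBound_mean_close {G : SimpleGraph V} [DecidableRel G.Adj] (hG : G.Connected)
    (f : ℕ → V → ℝ) (g : V) (r : ℕ) (hr : r < Fintype.card V) :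
    ∃ A : Finset V, A.card = r + 1 ∧ OscBound G A ∧
      |f 0 g - mean A (f r)| ≤ ∑ i ∈ Finset.range r, √(1 / (i + 1)) *
        (√(verticalEnergy (f i) (f (i + 1))) + √(energyOn G Finset.univ (f (i + 1)))) := by
  classical
  induction r with
  | zero =>
    refine ⟨{g}, by simp, ?_, by simp [mean]⟩
    intro F a ha b hb
    rw [Finset.mem_singleton.1 ha, Finset.mem_singleton.1 hb]
    have := energyOn_nonneg G {g} F
    rw [sub_self, zero_pow two_ne_zero]
    positivity
  | succ r ih =>
    obtain ⟨A, hc, hosc, hA⟩ := ih (by omega)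
    have hne : A.Nonempty := Finset.card_pos.1 (by omega)
    obtain ⟨b, hb, hosc'⟩ := exists_oscBound_insert hG hne (by omega) hosc
    refine ⟨insert b A, by rw [Finset.card_insert_of_notMem hb, hc], hosc', ?_⟩
    have hcr : (A.card : ℝ) = r + 1 := by rw [hc]; push_cast; ring
    have h1 : |mean A (f r) - mean A (f (r + 1))| ≤
        √(1 / (r + 1)) * √(verticalEnergy (f r) (f (r + 1))) := by
      rw [← Real.sqrt_mul (by positivity)]
      refine Real.abs_le_sqrt ?_
      rw [mean_sub]
      refine (sq_mean_le _ _).trans (le_of_eq ?_)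
      rw [hcr, verticalEnergy]
      ring
    have h2 : |mean A (f (r + 1)) - mean (insert b A) (f (r + 1))| ≤
        √(1 / (r + 1)) * √(energyOn G Finset.univ (f (r + 1))) := by
      rw [← Real.sqrt_mul (by positivity)]
      refine Real.abs_le_sqrt ((sq_mean_sub_mean_insert_le hne hb hosc' _).trans (le_of_eq ?_))
      rw [hcr]
      ring
    rw [Finset.sum_range_succ, mul_add]
    have h3 := abs_sub_le (f 0 g) (mean A (f r)) (mean (insert b A) (f (r + 1)))
    have h4 := abs_sub_le (mean A (f r)) (mean A (f (r + 1))) (mean (insert b A) (f (r + 1)))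
    linarith

theorem sum_one_div_le_log (n : ℕ) :
    ∑ i ∈ Finset.range n, (1 : ℝ) / (i + 1) ≤ 1 + Real.log n := by
  refine le_trans (le_of_eq ?_) (harmonic_le_one_add_log n)
  rw [harmonic]
  push_cast
  simp

theorem sq_sub_mean_level_le {G : SimpleGraph V} [DecidableRel G.Adj] (hG : G.Connected)
    (f : ℕ → V → ℝ) (g : V) :
    (f 0 g - mean Finset.univ (f 0)) ^ 2 ≤ (6 + 4 * Real.log (Fintype.card V)) *
      ∑ i ∈ Finset.range (Fintype.card V),
        (verticalEnergy (f i) (f (i + 1)) + energyOn G Finset.univ (f i)) := by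
  have : Nonempty V := ⟨g⟩
  obtain ⟨m, hm⟩ : ∃ m, Fintype.card V = m + 1 := ⟨_, (Nat.succ_pred Fintype.card_ne_zero).symm⟩
  obtain ⟨A, hc, -, hA⟩ := exists_oscBound_mean_close hG f g m (by omega)
  have hAu : A = Finset.univ := (Finset.card_eq_iff_eq_univ _).1 (hc.trans hm.symm)
  subst hAu
  set v : ℕ → ℝ := fun i => verticalEnergy (f i) (f (i + 1))
  set e : ℕ → ℝ := fun i => energyOn G Finset.univ (f i)
  have hv : ∀ i, 0 ≤ v i := fun i => verticalEnergy_nonneg _ _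
  have he : ∀ i, 0 ≤ e i := fun i => energyOn_nonneg _ _ _
  set S := ∑ i ∈ Finset.range (m + 1), (v i + e i)
  have hSv : ∑ i ∈ Finset.range m, v i + ∑ i ∈ Finset.range m, e (i + 1) ≤ S := by
    simp only [S, Finset.sum_add_distrib]
    rw [Finset.sum_range_succ' e, Finset.sum_range_succ v]
    linarith [hv m, he 0]
  have hS0 : 0 ≤ S := Finset.sum_nonneg fun i _ => add_nonneg (hv i) (he i)
  have hSe : 0 ≤ ∑ i ∈ Finset.range m, e (i + 1) := Finset.sum_nonneg fun i _ => he _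
  have hlog : 0 ≤ Real.log (Fintype.card V) := Real.log_natCast_nonneg _
  have h1 : (f 0 g - mean Finset.univ (f m)) ^ 2 ≤ (1 + Real.log (Fintype.card V)) * (2 * S) := by
    rw [← sq_abs]
    refine (pow_le_pow_left₀ (abs_nonneg _) hA 2).trans ?_
    refine (Finset.sum_mul_sq_le_sq_mul_sq _ _ _).trans ?_
    have hH : ∑ i ∈ Finset.range m, √((1 : ℝ) / (i + 1)) ^ 2 ≤
        1 + Real.log (Fintype.card V) := by
      refine le_trans (le_of_eq (Finset.sum_congr rfl fun i _ => Real.sq_sqrt (by positivity)))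
        ((sum_one_div_le_log m).trans ?_)
      rcases Nat.eq_zero_or_pos m with rfl | hm0
      · simpa using hlog
      · gcongr
        omega
    have hT : ∑ i ∈ Finset.range m, (√(v i) + √(e (i + 1))) ^ 2 ≤ 2 * S := by
      have : ∀ i ∈ Finset.range m, (√(v i) + √(e (i + 1))) ^ 2 ≤ 2 * (v i + e (i + 1)) := by
        intro i _
        have h1 := Real.sq_sqrt (hv i)
        have h2 := Real.sq_sqrt (he (i + 1))
        nlinarith [sq_nonneg (√(v i) - √(e (i + 1)))]
      refine (Finset.sum_le_sum this).trans ?_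
      rw [← Finset.mul_sum, Finset.sum_add_distrib]
      linarith
    gcongr
  have h2 : (mean Finset.univ (f 0) - mean Finset.univ (f m)) ^ 2 ≤ S := by
    have htel : mean Finset.univ (f 0) - mean Finset.univ (f m) =
        ∑ i ∈ Finset.range m, (mean Finset.univ (f i) - mean Finset.univ (f (i + 1))) :=
      (Finset.sum_range_sub' (fun i => mean Finset.univ (f i)) m).symm
    have hn : (0 : ℝ) < m + 1 := by positivity
    have hcu : ((Finset.univ : Finset V).card : ℝ) = m + 1 := by
      rw [Finset.card_univ, hm]; push_cast; ring
    have hterm : ∀ i ∈ Finset.range m,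
        (mean Finset.univ (f i) - mean Finset.univ (f (i + 1))) ^ 2 ≤ v i / (m + 1) := by
      intro i _
      rw [mean_sub]
      refine (sq_mean_le _ _).trans (le_of_eq ?_)
      rw [hcu]
      rfl
    have hcs := sq_sum_le_card_mul_sum_sq (s := Finset.range m)
      (f := fun i => mean Finset.univ (f i) - mean Finset.univ (f (i + 1)))
    rw [htel]
    refine hcs.trans ?_
    rw [Finset.card_range]
    calc (m : ℝ) * _ ≤ m * ∑ i ∈ Finset.range m, v i / (m + 1) := by
          gcongr with i hi; exact hterm i hi
      _ = (m / (m + 1)) * ∑ i ∈ Finset.range m, v i := by rw [← Finset.sum_div]; ring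
      _ ≤ 1 * ∑ i ∈ Finset.range m, v i := by
          have : 0 ≤ ∑ i ∈ Finset.range m, v i := Finset.sum_nonneg fun i _ => hv i
          gcongr
          rw [div_le_one hn]; linarith
      _ ≤ S := by linarith
  rw [hm] at hlog h1 ⊢
  -- Both quantities are compared with the mean on level m; the constant is 2 · 2(1 + log n) + 2 = 6
  -- + 4 log n.
  have h3 : (f 0 g - mean Finset.univ (f 0)) ^ 2 ≤
      2 * (f 0 g - mean Finset.univ (f m)) ^ 2 +
      2 * (mean Finset.univ (f 0) - mean Finset.univ (f m)) ^ 2 := by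
    nlinarith [sq_nonneg ((f 0 g - mean Finset.univ (f m)) +
      (mean Finset.univ (f 0) - mean Finset.univ (f m)))]
  change _ ≤ _ * S
  nlinarith

/-- Pairing of `f` with minus its (unnormalized) Laplacian on one level. -/
noncomputable def levelPairing (G : SimpleGraph V) [DecidableRel G.Adj] (f : V × ℤ → ℝ) (z : ℤ) :
    ℝ :=
  ∑ g, f (g, z) * ((G.degree g + 2) * (f (g, z) - stepOp G f (g, z)))

theorem sum_mul_sum_neighbor_sub (G : SimpleGraph V) [DecidableRel G.Adj] (F : V → ℝ) :
    ∑ g, F g * (G.degree g * F g - ∑ h ∈ G.neighborFinset g, F h) =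
      energyOn G Finset.univ F / 2 := by
  have h1 : ∀ g, F g * (G.degree g * F g - ∑ h ∈ G.neighborFinset g, F h) =
      ∑ h, if G.Adj g h then F g * (F g - F h) else 0 := by
    intro g
    rw [← Finset.sum_filter, ← SimpleGraph.neighborFinset_eq_filter, ← Finset.mul_sum,
      Finset.sum_sub_distrib, Finset.sum_const, SimpleGraph.card_neighborFinset_eq_degree,
      nsmul_eq_mul]
  have h2 : ∑ g, ∑ h, (if G.Adj g h then F g * (F g - F h) else 0) =
      ∑ g, ∑ h, if G.Adj g h then F h * (F h - F g) else 0 := by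
    rw [Finset.sum_comm]
    simp only [G.adj_comm]
  have h3 : energyOn G Finset.univ F =
      ∑ g, ∑ h, (if G.Adj g h then F g * (F g - F h) else 0) +
      ∑ g, ∑ h, if G.Adj g h then F h * (F h - F g) else 0 := by
    rw [energyOn, ← Finset.sum_add_distrib]
    refine Finset.sum_congr rfl fun g _ => ?_
    rw [← Finset.sum_add_distrib]
    refine Finset.sum_congr rfl fun h _ => ?_
    split_ifs <;> ring
  rw [Finset.sum_congr rfl fun g _ => h1 g, h3, ← h2]
  ring

/-- Summation by parts on one level. The last bracket is the increment from z to z + 1 of a single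
function, so it telescopes over levels. -/
theorem levelPairing_eq (G : SimpleGraph V) [DecidableRel G.Adj] (f : V × ℤ → ℝ) (z : ℤ) :
    levelPairing G f z = energyOn G Finset.univ (fun g => f (g, z)) / 2 +
      verticalEnergy (fun g => f (g, z)) (fun g => f (g, z + 1)) +
      (∑ g, (f (g, z + 1) * f (g, z) - f (g, z + 1) ^ 2) -
        ∑ g, (f (g, z) * f (g, z - 1) - f (g, z) ^ 2)) := by
  rw [← sum_mul_sum_neighbor_sub, verticalEnergy, levelPairing, ← Finset.sum_sub_distrib,
    ← Finset.sum_add_distrib, ← Finset.sum_add_distrib]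
  refine Finset.sum_congr rfl fun g _ => ?_
  have : (G.degree g : ℝ) + 2 ≠ 0 := by positivity
  rw [stepOp]
  field_simp
  ring

theorem sum_levelPairing_eq (G : SimpleGraph V) [DecidableRel G.Adj] (f : V × ℤ → ℝ) (K : ℕ)
    (hf : ∀ x : V × ℤ, (K : ℤ) ≤ |x.2| → f x = 0) :
    ∑ i ∈ Finset.range (K + K), levelPairing G f (i - K) =
      ∑ i ∈ Finset.range (K + K), (energyOn G Finset.univ (fun g => f (g, (i - K : ℤ))) / 2 +
        verticalEnergy (fun g => f (g, (i - K : ℤ))) (fun g => f (g, (i - K : ℤ) + 1))) := by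
  have htel := Finset.sum_range_sub (fun i : ℕ =>
    ∑ g, (f (g, (i - K : ℤ)) * f (g, (i - K : ℤ) - 1) - f (g, (i - K : ℤ)) ^ 2)) (K + K)
  have h0 : ∀ g, f (g, ((0 : ℕ) - K : ℤ)) = 0 := fun g => hf _ (by simp)
  have h1 : ∀ g, f (g, ((K + K : ℕ) - K : ℤ)) = 0 := fun g => hf _ (by simp)
  simp only [h0, h1] at htel
  simp only [levelPairing_eq]
  rw [Finset.sum_add_distrib]
  have : ∑ x ∈ Finset.range (K + K),
      (∑ g, (f (g, (x - K : ℤ) + 1) * f (g, (x - K : ℤ)) - f (g, (x - K : ℤ) + 1) ^ 2) -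
        ∑ g, (f (g, (x - K : ℤ)) * f (g, (x - K : ℤ) - 1) - f (g, (x - K : ℤ)) ^ 2)) = 0 := by
    -- Zero is rewritten as the difference of the two boundary terms, both of which vanish by the
    -- support condition.
    rw [show (0 : ℝ) = ∑ g : V, (0 * f (g, ((K + K : ℕ) - K : ℤ) - 1) - 0 ^ 2) -
      ∑ g : V, (0 * f (g, ((0 : ℕ) - K : ℤ) - 1) - 0 ^ 2) by simp, ← htel]
    refine Finset.sum_congr rfl fun i _ => ?_
    have : ((i + 1 : ℕ) - K : ℤ) = (i - K : ℤ) + 1 := by push_cast; ring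
    rw [this, add_sub_cancel_right]
  rw [this, add_zero]

/-- For a function of finite support on the cylinder, the squared deviation from the mean on level
zero is controlled by the Dirichlet energy, with a logarithmic constant. -/
theorem sq_sub_mean_le {G : SimpleGraph V} [DecidableRel G.Adj] (hG : G.Connected)
    (f : V × ℤ → ℝ) (K : ℕ) (hK : Fintype.card V ≤ K)
    (hf : ∀ x : V × ℤ, (K : ℤ) ≤ |x.2| → f x = 0) (g : V) :
    (f (g, 0) - mean Finset.univ (fun h => f (h, 0))) ^ 2 ≤
      (12 + 8 * Real.log (Fintype.card V)) *
        ∑ i ∈ Finset.range (K + K), levelPairing G f (i - K) := by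
  have h1 := sq_sub_mean_level_le hG (fun i h => f (h, (i : ℤ))) g
  have hlog : 0 ≤ Real.log (Fintype.card V) := Real.log_natCast_nonneg _
  -- The pairing contains only half of `energyOn`, hence the factor 2; n ≤ K puts levels 0 to n - 1
  -- inside the summation range.
  have h2 : ∑ i ∈ Finset.range (Fintype.card V),
      (verticalEnergy (fun h => f (h, (i : ℤ))) (fun h => f (h, ((i + 1 : ℕ) : ℤ))) +
        energyOn G Finset.univ (fun h => f (h, (i : ℤ)))) ≤
      2 * ∑ i ∈ Finset.range (K + K), levelPairing G f (i - K) := by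
    rw [sum_levelPairing_eq G f K hf, Finset.sum_range_add, mul_add]
    have hnn : ∀ z z' : ℤ, 0 ≤ energyOn G Finset.univ (fun g => f (g, z)) / 2 +
        verticalEnergy (fun g => f (g, z)) (fun g => f (g, z')) := fun z z' => by
      have := energyOn_nonneg G Finset.univ (fun g => f (g, z))
      have := verticalEnergy_nonneg (fun g => f (g, z)) (fun g => f (g, z'))
      positivity
    have hA : 0 ≤ 2 * ∑ i ∈ Finset.range K,
        (energyOn G Finset.univ (fun g => f (g, (i - K : ℤ))) / 2 +
        verticalEnergy (fun g => f (g, (i - K : ℤ))) (fun g => f (g, (i - K : ℤ) + 1))) :=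
      mul_nonneg zero_le_two (Finset.sum_nonneg fun i _ => hnn _ _)
    refine le_trans ?_ (le_add_of_nonneg_left hA)
    rw [Finset.mul_sum]
    refine le_trans (Finset.sum_le_sum_of_subset_of_nonneg (Finset.range_mono hK)
      fun i _ _ => add_nonneg (verticalEnergy_nonneg _ _) (energyOn_nonneg _ _ _)) ?_
    refine Finset.sum_le_sum fun i _ => ?_
    have hz : ((K + i : ℕ) - K : ℤ) = i := by push_cast; ring
    rw [hz]
    push_cast
    have := verticalEnergy_nonneg (fun g => f (g, (i : ℤ))) (fun g => f (g, (i : ℤ) + 1))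
    linarith
  simp only [Nat.cast_zero] at h1
  refine h1.trans ?_
  calc _ ≤ (6 + 4 * Real.log (Fintype.card V)) *
        (2 * ∑ i ∈ Finset.range (K + K), levelPairing G f (i - K)) := by gcongr
    _ = _ := by ring

end Energy

/-! ### Visits to level zero and hitting a point -/

section Hitting

variable {V : Type*}

/-- Number of visits to level zero among the first `t` times. -/
noncomputable def visitCount (ω : ℕ → V × ℤ) (t : ℕ) : ℕ :=
  ((Finset.range t).filter fun s => (ω s).2 = 0).card

theorem prod_levelWeight (ω : ℕ → V × ℤ) (t : ℕ) (a : ℝ) :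
    ∏ s ∈ Finset.range t, ENNReal.ofReal (if (ω s).2 = 0 then a else 1) =
      ENNReal.ofReal a ^ visitCount ω t := by
  rw [visitCount, ← Finset.prod_const, Finset.prod_filter]
  refine Finset.prod_congr rfl fun s _ => ?_
  split_ifs <;> simp

/-- Potential for the lower bound on the number of visits to level zero; `r` is the time left. -/
noncomputable def visitPotential (a : ℝ) (R t : ℕ) (r : ℕ) (z : ℤ) : ℝ :=
  a + 2 * |(z : ℝ)| / R - (z : ℝ) ^ 2 / R ^ 2 + 1 - r / t

theorem visitPotential_second_diff_of_ne (a : ℝ) (R t r : ℕ) {z : ℤ} (hz : z ≠ 0) :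
    visitPotential a R t r (z + 1) + visitPotential a R t r (z - 1) -
      2 * visitPotential a R t r z = -2 / R ^ 2 := by
  have habs : |((z + 1 : ℤ) : ℝ)| + |((z - 1 : ℤ) : ℝ)| = 2 * |(z : ℝ)| := by
    have : |z + 1| + |z - 1| = 2 * |z| := by
      rcases abs_cases z with h | h <;> rcases abs_cases (z + 1) with h' | h' <;>
        rcases abs_cases (z - 1) with h'' | h'' <;> omega
    exact_mod_cast this
  have e : |((z + 1 : ℤ) : ℝ)| = 2 * |(z : ℝ)| - |((z - 1 : ℤ) : ℝ)| := by linarith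
  unfold visitPotential
  rw [e]
  push_cast
  ring

variable [Fintype V]

open Classical in
/-- The expected number of visits to level zero, among the first `t` times, before the walk hits
the point `(y, 0)`. -/
noncomputable def expVisits (G : SimpleGraph V) [DecidableRel G.Adj] (y : V) :
    ℕ → V × ℤ → ℝ
  | 0 => fun _ => 0
  | t + 1 => fun x => if x = (y, 0) then 0 else
      (if x.2 = 0 then 1 else 0) + stepOp G (expVisits G y t) x

variable (G : SimpleGraph V) [DecidableRel G.Adj] (y : V)

theorem expVisits_succ_of_ne {t : ℕ} {x : V × ℤ} (hx : x ≠ (y, 0)) :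
    expVisits G y (t + 1) x = (if x.2 = 0 then 1 else 0) + stepOp G (expVisits G y t) x := by
  rw [expVisits]
  exact if_neg hx

theorem expVisits_self (t : ℕ) : expVisits G y t (y, 0) = 0 := by
  cases t with
  | zero => rfl
  | succ t =>
    rw [expVisits]
    exact if_pos rfl

theorem expVisits_nonneg (t : ℕ) (x : V × ℤ) : 0 ≤ expVisits G y t x := by
  induction t generalizing x with
  | zero => exact le_rfl
  | succ t ih =>
    have := stepOp_nonneg G ih x
    rw [expVisits]
    dsimp only
    split_ifs <;> linarith

theorem expVisits_le_succ (t : ℕ) (x : V × ℤ) :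
    expVisits G y t x ≤ expVisits G y (t + 1) x := by
  induction t generalizing x with
  | zero => exact expVisits_nonneg G y 1 x
  | succ t ih =>
    rcases eq_or_ne x (y, 0) with rfl | hx
    · rw [expVisits_self, expVisits_self]
    · rw [expVisits_succ_of_ne G y hx, expVisits_succ_of_ne G y hx]
      have := stepOp_mono G (x := x) (fun h _ => ih (h, x.2)) (ih (x.1, x.2 + 1))
        (ih (x.1, x.2 - 1))
      linarith

/-- Level zero is out of reach at times 0 to t - 1. This supplies the finite support needed for
summation by parts. -/
theorem expVisits_eq_zero (t : ℕ) (x : V × ℤ) (hx : (t : ℤ) ≤ |x.2|) :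
    expVisits G y t x = 0 := by
  induction t generalizing x with
  | zero => rfl
  | succ t ih =>
    push_cast at hx
    have h0 : x.2 ≠ 0 := by
      intro h
      rw [h, abs_zero] at hx
      omega
    have hne : x ≠ (y, 0) := fun h => h0 (by rw [h])
    have hs : ∑ h ∈ G.neighborFinset x.1, expVisits G y t (h, x.2) = 0 :=
      Finset.sum_eq_zero fun h _ => ih _ (by change (t : ℤ) ≤ |x.2|; omega)
    have hu : expVisits G y t (x.1, x.2 + 1) = 0 := ih _ (by
      change (t : ℤ) ≤ |x.2 + 1|
      rcases abs_cases x.2 with h | h <;> rcases abs_cases (x.2 + 1) with h' | h' <;> omega)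
    have hd : expVisits G y t (x.1, x.2 - 1) = 0 := ih _ (by
      change (t : ℤ) ≤ |x.2 - 1|
      rcases abs_cases x.2 with h | h <;> rcases abs_cases (x.2 - 1) with h' | h' <;> omega)
    rw [expVisits_succ_of_ne G y hne, if_neg h0, stepOp, hs, hu, hd]
    simp

/-- Monotonicity in the horizon t makes f minus its average at most the indicator of level zero,
away from (y, 0). At (y, 0) the factor f vanishes. -/
theorem levelPairing_expVisits_le (t : ℕ) (z : ℤ) :
    levelPairing G (expVisits G y t) z ≤
      if z = 0 then ∑ g, (G.maxDegree + 2) * expVisits G y t (g, 0) else 0 := by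
  have hpt : ∀ g, expVisits G y t (g, z) *
      ((G.degree g + 2) * (expVisits G y t (g, z) - stepOp G (expVisits G y t) (g, z))) ≤
      if z = 0 then (G.maxDegree + 2) * expVisits G y t (g, 0) else 0 := by
    intro g
    have h0 := expVisits_nonneg G y t (g, z)
    rcases eq_or_ne (g, z) (y, 0) with h | h
    · have : expVisits G y t (g, z) = 0 := by rw [h, expVisits_self]
      rw [this, zero_mul]
      split_ifs
      · exact mul_nonneg (by positivity) (expVisits_nonneg G y t _)
      · exact le_rfl
    · have h1 := expVisits_le_succ G y t (g, z)
      rw [expVisits_succ_of_ne G y h] at h1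
      dsimp only at h1
      have hd : (G.degree g : ℝ) ≤ G.maxDegree := by exact_mod_cast G.degree_le_maxDegree g
      have hd0 : (0 : ℝ) ≤ G.degree g := by positivity
      split_ifs at h1 ⊢ with hz
      · subst hz
        calc _ ≤ expVisits G y t (g, 0) * ((G.degree g + 2) * 1) := by
              gcongr; linarith
          _ ≤ _ := by nlinarith
      · exact mul_nonpos_of_nonneg_of_nonpos h0
          (mul_nonpos_of_nonneg_of_nonpos (by positivity) (by linarith))
  unfold levelPairing
  refine (Finset.sum_le_sum fun g _ => hpt g).trans ?_
  split_ifs <;> simp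

/-- Upper bound for the expected number of visits to level zero before hitting a given point of
level zero. -/
noncomputable def visitBound : ℝ :=
  2 * ((12 + 8 * Real.log (Fintype.card V)) * ((G.maxDegree + 2) * Fintype.card V))

variable {G}

/-- The energy is linear in the mean m while the deviation at y, where f vanishes, equals m: m² ≤ B
m bounds m uniformly in t. -/
theorem expVisits_zero_level_le (hG : G.Connected) (t : ℕ) (g : V) :
    expVisits G y t (g, 0) ≤ visitBound G := by
  have : Nonempty V := ⟨g⟩
  set n := Fintype.card V
  set K := max n t
  set f := expVisits G y t
  have hK : (n : ℤ) ≤ K := by simp [K]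
  have hKt : (t : ℤ) ≤ K := by simp [K]
  have hsupp : ∀ x : V × ℤ, (K : ℤ) ≤ |x.2| → f x = 0 :=
    fun x hx => expVisits_eq_zero G y t x (by omega)
  have hn : (0 : ℝ) < n := by exact_mod_cast Fintype.card_pos
  set m := mean Finset.univ (fun h => f (h, 0)) with hm
  have hsum : ∑ h, f (h, 0) = n * m := by
    rw [hm, mean, Finset.card_univ]; field_simp; rfl
  have hm0 : 0 ≤ m := by
    have : 0 ≤ ∑ h, f (h, 0) := Finset.sum_nonneg fun h _ => expVisits_nonneg G y t _
    rw [hsum] at this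
    exact nonneg_of_mul_nonneg_right this hn
  have hpair : ∑ i ∈ Finset.range (K + K), levelPairing G f (i - K) ≤
      (G.maxDegree + 2) * n * m := by
    refine (Finset.sum_le_sum fun i _ => levelPairing_expVisits_le G y t _).trans ?_
    have hiff : ∀ i : ℕ, ((i : ℤ) - K = 0) ↔ i = K := fun i => by omega
    simp only [hiff]
    rw [Finset.sum_ite_eq', ← Finset.mul_sum, hsum, mul_assoc]
    split_ifs
    · exact le_rfl
    · positivity
  set L := 12 + 8 * Real.log n
  have hL : 0 ≤ L := by have := Real.log_natCast_nonneg n; positivity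
  set B := L * ((G.maxDegree + 2) * n) with hB
  have hB0 : 0 ≤ B := by positivity
  have key : ∀ h : V, (f (h, 0) - m) ^ 2 ≤ B * m := fun h => by
    refine (sq_sub_mean_le hG f K (le_max_left _ _) hsupp h).trans ?_
    calc _ ≤ L * ((G.maxDegree + 2) * n * m) := by gcongr
      _ = _ := by rw [hB]; ring
  have hmB : m ≤ B := by
    have h := key y
    rw [show f (y, 0) = 0 from expVisits_self G y t] at h
    by_contra! hlt
    nlinarith
  have h := key g
  have h2 : f (g, 0) - m ≤ B := abs_le_of_sq_le_sq' (by nlinarith) hB0 |>.2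
  change f (g, 0) ≤ 2 * B
  linarith

theorem visitBound_ge_one [Nonempty V] : 1 ≤ visitBound G := by
  unfold visitBound
  have hn : (1 : ℝ) ≤ Fintype.card V := by exact_mod_cast Fintype.card_pos
  have := Real.log_nonneg hn
  have hd : (0 : ℝ) ≤ G.maxDegree := by positivity
  have h1 : 1 ≤ ((G.maxDegree : ℝ) + 2) * Fintype.card V := by nlinarith
  nlinarith

theorem expVisits_le (hG : G.Connected) (t : ℕ) (x : V × ℤ) :
    expVisits G y t x ≤ visitBound G := by
  have : Nonempty V := ⟨y⟩
  induction t generalizing x with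
  | zero => exact zero_le_one.trans visitBound_ge_one
  | succ t ih =>
    obtain ⟨g, z⟩ := x
    rcases eq_or_ne z 0 with rfl | hz
    · exact expVisits_zero_level_le y hG _ g
    · rw [expVisits_succ_of_ne G y (by simp [hz]), if_neg hz, zero_add]
      exact stepOp_le_of_le G ih _

theorem stepOp_level (G : SimpleGraph V) [DecidableRel G.Adj] (φ : ℤ → ℝ) (x : V × ℤ) :
    stepOp G (fun x => φ x.2) x = φ x.2 +
      (φ (x.2 + 1) + φ (x.2 - 1) - 2 * φ x.2) / (G.degree x.1 + 2) := by
  unfold stepOp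
  dsimp only
  rw [Finset.sum_const, SimpleGraph.card_neighborFinset_eq_degree, nsmul_eq_mul]
  have : (G.degree x.1 : ℝ) + 2 ≠ 0 := by positivity
  field_simp
  ring

variable [MeasurableSpace V] [DiscreteMeasurableSpace V]

/-- Khas'minskii's argument: a uniform bound D on the mean number of visits yields an exponential
moment, to which Markov's inequality applies. -/
theorem measure_many_visits_not_hit_le (hG : G.Connected) {μ : Measure (ℕ → V × ℤ)}
    (hμ : IsWalk G μ) (t l : ℕ) :
    μ {ω | (∀ s < t, ω s ≠ (y, 0)) ∧ l ≤ visitCount ω t} ≤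
      ENNReal.ofReal (2 * (1 - 1 / (2 * visitBound G)) ^ l) * μ Set.univ := by
  classical
  have : Nonempty V := ⟨y⟩
  set D := visitBound G
  have hD : 1 ≤ D := visitBound_ge_one
  set q := 1 - 1 / (2 * D) with hq
  have hq0 : 0 < q := by
    have : 1 / (2 * D) < 1 := by rw [div_lt_one (by positivity)]; linarith
    linarith
  have hq1 : 1 ≤ q⁻¹ := (one_le_inv₀ hq0).2 (by
    have : 0 ≤ 1 / (2 * D) := by positivity
    linarith)
  set c : V × ℤ → ℝ := fun x => if x = (y, 0) then 0 else if x.2 = 0 then q⁻¹ else 1 with hc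
  set f : ℕ → V × ℤ → ℝ := fun s x => 1 + 1 / D * expVisits G y (t - s) x with hf
  have hc0 : ∀ x, 0 ≤ c x := fun x => by simp only [hc]; split_ifs <;> positivity
  have hf0 : ∀ s x, 0 ≤ f s x := fun s x => by
    have := expVisits_nonneg G y (t - s) x
    positivity
  have hstep : ∀ s < t, ∀ x, c x * stepOp G (f (s + 1)) x ≤ f s x := by
    intro s hs x
    simp only [hf]
    rw [stepOp_affine]
    obtain ⟨r, hr⟩ : ∃ r, t - s = r + 1 := ⟨t - s - 1, by omega⟩
    rw [show t - (s + 1) = r by omega, hr]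
    rcases eq_or_ne x (y, 0) with hx | hx
    · have := expVisits_nonneg G y (r + 1) x
      simp only [hc, if_pos hx, zero_mul]
      positivity
    · have hle := expVisits_le y hG (r + 1) x
      rw [expVisits_succ_of_ne G y hx] at hle ⊢
      simp only [hc, if_neg hx]
      split_ifs at hle ⊢ with h0
      · rw [inv_mul_le_iff₀ hq0]
        set u := stepOp G (expVisits G y r) x
        have hu : u / D ≤ 1 - 1 / D := by
          rw [div_le_iff₀ (by positivity), sub_mul, div_mul_cancel₀ _ (by positivity)]; linarith
        have e1 : 1 / D * u = u / D := by ring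
        -- As 1 + u ≤ D, the bracket is at most 2, so the factor q loses at most 1/D, which is
        -- exactly what the visit adds.
        have e2 : q * (1 + 1 / D * (1 + u)) =
          (1 + u / D) + 1 / D - 1 / D * (1 + (u / D + 1 / D)) / 2 := by rw [hq]; field_simp; ring
        rw [e1, e2]
        have : 0 < 1 / D := by positivity
        nlinarith
      · rw [zero_add, one_mul]
  have hFK := hμ.lintegral_prod_le hc0 hf0 t hstep
  have hR : ∫⁻ ω, ENNReal.ofReal (f 0 (ω 0)) ∂μ ≤ ENNReal.ofReal 2 * μ Set.univ := by
    rw [← lintegral_const]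
    refine lintegral_mono fun ω => ENNReal.ofReal_le_ofReal ?_
    have hle := expVisits_le y hG (t - 0) (ω 0)
    simp only [hf]
    have : 1 / D * expVisits G y (t - 0) (ω 0) ≤ 1 := by
      rw [one_div, inv_mul_le_iff₀ (by positivity)]; linarith
    linarith
  have hft : ∀ x, f t x = 1 := fun x => by simp [hf, expVisits]
  simp only [hft, ENNReal.ofReal_one, mul_one] at hFK
  have hmeas : Measurable fun ω : ℕ → V × ℤ =>
      ∏ s ∈ Finset.range t, ENNReal.ofReal (c (ω s)) :=
    Finset.measurable_fun_prod _ fun s _ =>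
      (measurable_of_countable fun x : V × ℤ => ENNReal.ofReal (c x)).comp (measurable_pi_apply s)
  have hmk := mul_meas_ge_le_lintegral (μ := μ) hmeas (ENNReal.ofReal (q⁻¹ ^ l))
  have hsub : {ω : ℕ → V × ℤ | (∀ s < t, ω s ≠ (y, 0)) ∧ l ≤ visitCount ω t} ⊆
      {ω | ENNReal.ofReal (q⁻¹ ^ l) ≤ ∏ s ∈ Finset.range t, ENNReal.ofReal (c (ω s))} := by
    rintro ω ⟨h1, h2⟩
    have : ∏ s ∈ Finset.range t, ENNReal.ofReal (c (ω s)) = ENNReal.ofReal q⁻¹ ^ visitCount ω t := by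
      rw [← prod_levelWeight]
      exact Finset.prod_congr rfl fun s hs => by
        simp only [hc, if_neg (h1 s (Finset.mem_range.1 hs))]
    rw [Set.mem_ofPred_eq, this, ← ENNReal.ofReal_pow (by positivity)]
    exact ENNReal.ofReal_le_ofReal (pow_le_pow_right₀ hq1 h2)
  have htot := (mul_le_mul_right (measure_mono (μ := μ) hsub) (ENNReal.ofReal (q⁻¹ ^ l))).trans
    (hmk.trans (hFK.trans hR))
  calc _ = ENNReal.ofReal (q ^ l) * (ENNReal.ofReal (q⁻¹ ^ l) *
        μ {ω | (∀ s < t, ω s ≠ (y, 0)) ∧ l ≤ visitCount ω t}) := by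
        rw [← mul_assoc, ← ENNReal.ofReal_mul (by positivity), ← mul_pow, mul_inv_cancel₀ hq0.ne',
          one_pow, ENNReal.ofReal_one, one_mul]
    _ ≤ ENNReal.ofReal (q ^ l) * (ENNReal.ofReal 2 * μ Set.univ) := by gcongr
    _ = _ := by
      rw [← mul_assoc, ← ENNReal.ofReal_mul (by positivity), mul_comm (q ^ l)]

/-- Each visit is discounted by θ = 1 - 1/(2l). By Bernoulli, fewer than l visits leave a weight of
at least 1/2, while a supersolution bounds the mean weight by a = 6l/R. -/
theorem measure_few_visits_le {μ : Measure (ℕ → V × ℤ)} (hμ : IsWalk G μ)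
    (h0 : ∀ᵐ ω ∂μ, (ω 0).2 = 0) {l R : ℕ} (hl : 0 < l) (hR : 0 < R) :
    μ {ω | visitCount ω ((G.maxDegree + 2) * R ^ 2) < l} ≤
      ENNReal.ofReal (12 * l / R) * μ Set.univ := by
  set t := (G.maxDegree + 2) * R ^ 2 with ht
  have hRr : (1 : ℝ) ≤ R := by exact_mod_cast hR
  have hlr : (1 : ℝ) ≤ l := by exact_mod_cast hl
  have htr : (t : ℝ) = (G.maxDegree + 2) * R ^ 2 := by rw [ht]; push_cast; ring
  have ht0 : (0 : ℝ) < t := by rw [htr]; positivity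
  have htR : (R : ℝ) ≤ t := by
    rw [htr]
    have : (0 : ℝ) ≤ G.maxDegree := by positivity
    nlinarith
  set θ : ℝ := 1 - 1 / (2 * l) with hθ
  have hθ0 : 0 ≤ θ := by
    have : 1 / (2 * (l : ℝ)) ≤ 1 := by rw [div_le_one (by positivity)]; linarith
    linarith
  have hθ1 : θ ≤ 1 := by
    have : 0 ≤ 1 / (2 * (l : ℝ)) := by positivity
    linarith
  have hθl : 1 / 2 ≤ θ ^ l := by
    have := one_add_mul_le_pow (a := -(1 / (2 * (l : ℝ)))) (by linarith) l
    have e : 1 + (l : ℝ) * -(1 / (2 * l)) = 1 / 2 := by field_simp; ring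
    rw [e] at this
    simpa [hθ, sub_eq_add_neg] using this
  set a : ℝ := 6 * l / R with ha
  have ha0 : 0 ≤ a := by positivity
  set W := visitPotential a R t with hW
  -- Capping at 1 keeps a supersolution across |z| = R, because W ≥ 1 there while r ≤ t.
  set F : ℕ → ℤ → ℝ := fun r z => if |z| < R then min 1 (W r z) else 1 with hF
  have hF1 : ∀ r z, F r z ≤ 1 := fun r z => by
    simp only [hF]; split_ifs
    · exact min_le_left _ _
    · exact le_rfl
  have hprof : ∀ z : ℤ, |z| ≤ R → 0 ≤ 2 * |(z : ℝ)| / R - (z : ℝ) ^ 2 / R ^ 2 := by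
    intro z hz
    have hz' : |(z : ℝ)| ≤ R := by exact_mod_cast hz
    have e : 2 * |(z : ℝ)| / R - (z : ℝ) ^ 2 / R ^ 2 = |(z : ℝ)| * (2 * R - |(z : ℝ)|) / R ^ 2 := by
      rw [← sq_abs (z : ℝ)]; field_simp
    rw [e]
    have := abs_nonneg (z : ℝ)
    have : 0 ≤ 2 * (R : ℝ) - |(z : ℝ)| := by linarith
    positivity
  have hrt : ∀ r : ℕ, r ≤ t → (r : ℝ) / t ≤ 1 := fun r hr => by
    rw [div_le_one ht0]; exact_mod_cast hr
  have hF0 : ∀ r ≤ t, ∀ z, 0 ≤ F r z := fun r hr z => by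
    simp only [hF]; split_ifs with h
    · refine le_min zero_le_one ?_
      have := hprof z h.le
      have := hrt r hr
      simp only [hW, visitPotential]
      linarith
    · exact zero_le_one
  have hFW : ∀ r ≤ t, ∀ z : ℤ, |z| ≤ R → F r z ≤ W r z := fun r hr z hz => by
    simp only [hF]; split_ifs with h
    · exact min_le_right _ _
    · have hz' : |(z : ℝ)| = R := by
        have : |z| = R := le_antisymm hz (not_lt.1 h)
        exact_mod_cast this
      have := hrt r hr
      have e : 2 * |(z : ℝ)| / R - (z : ℝ) ^ 2 / R ^ 2 = 1 := by
        rw [← sq_abs, hz']; field_simp; ring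
      simp only [hW, visitPotential]
      linarith
  set c : V × ℤ → ℝ := fun x => if x.2 = 0 then θ else 1 with hc
  have hc0 : ∀ x, 0 ≤ c x := fun x => by simp only [hc]; split_ifs <;> linarith
  have hc1 : ∀ x, c x ≤ 1 := fun x => by simp only [hc]; split_ifs <;> linarith
  have hstep : ∀ r, r + 1 ≤ t → ∀ x : V × ℤ,
      c x * stepOp G (fun x => F r x.2) x ≤ F (r + 1) x.2 := by
    intro r hr x
    have htriv : c x * stepOp G (fun x => F r x.2) x ≤ 1 := by
      have h1 : stepOp G (fun x => F r x.2) x ≤ 1 := stepOp_le_of_le G (fun x => hF1 r x.2) x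
      have h2 : 0 ≤ stepOp G (fun x => F r x.2) x :=
        stepOp_nonneg G (fun x => hF0 r (by omega) x.2) x
      exact mul_le_one₀ (hc1 x) h2 h1
    by_cases hx : |x.2| < R
    swap
    · simpa only [hF, if_neg hx] using htriv
    simp only [hF, if_pos hx]
    refine le_min htriv ?_
    have hle : stepOp G (fun x => F r x.2) x ≤ stepOp G (fun x => W r x.2) x := by
      refine stepOp_mono G (fun h _ => hFW r (by omega) _ hx.le) (hFW r (by omega) _ ?_)
        (hFW r (by omega) _ ?_)
      · change |x.2 + 1| ≤ (R : ℤ)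
        have := abs_add_le x.2 1
        rw [abs_one] at this
        omega
      · change |x.2 - 1| ≤ (R : ℤ)
        have := abs_sub x.2 1
        rw [abs_one] at this
        omega
    refine (mul_le_mul_of_nonneg_left hle (hc0 x)).trans ?_
    rw [stepOp_level]
    have hdeg : (G.degree x.1 : ℝ) ≤ G.maxDegree := by exact_mod_cast G.degree_le_maxDegree x.1
    have hdeg0 : (0 : ℝ) ≤ G.degree x.1 := by positivity
    have hsucc : W (r + 1) x.2 = W r x.2 - 1 / t := by
      simp only [hW, visitPotential]; push_cast; ring
    rw [hsucc]
    -- On level zero the kink of |z| costs at most 2/R and the discount gains at least a/(2l) = 3/R;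
    -- the remaining 1/R pays for the clock term 1/t. Elsewhere concavity of the profile pays for
    -- it, which fixes t = (maximal degree + 2) R².
    by_cases hz : x.2 = 0
    · simp only [hc, hz, if_true]
      have hd : W r (0 + 1) + W r (0 - 1) - 2 * W r 0 = 4 / R - 2 / R ^ 2 := by
        simp only [hW, visitPotential]
        norm_num
        ring
      rw [hd]
      have hWa : a ≤ W r 0 := by
        have := hrt r (by omega)
        simp only [hW, visitPotential, Int.cast_zero, abs_zero]
        norm_num
        linarith
      have h1 : (4 / (R : ℝ) - 2 / R ^ 2) / (G.degree x.1 + 2) ≤ 2 / R := by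
        rw [div_le_iff₀ (by positivity)]
        have : 0 ≤ 2 / (R : ℝ) ^ 2 := by positivity
        have h3 : 0 ≤ 2 / (R : ℝ) * G.degree x.1 := by positivity
        have h4 : 2 / (R : ℝ) * 2 = 4 / R := by ring
        nlinarith
      have h2 : 1 / (t : ℝ) ≤ 1 / R := by gcongr
      have h3 : 0 ≤ 2 / (R : ℝ) := by positivity
      have h4 : 1 / (2 * (l : ℝ)) * a = 3 / R := by rw [ha]; field_simp; norm_num
      have h5 : 1 / (2 * (l : ℝ)) * a ≤ 1 / (2 * l) * W r 0 := by gcongr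
      calc _ ≤ θ * (W r 0 + 2 / R) := by gcongr
        _ = W r 0 - 1 / (2 * l) * W r 0 + θ * (2 / R) := by rw [hθ]; ring
        _ ≤ W r 0 - 3 / R + 1 * (2 / R) := by rw [← h4]; gcongr
        _ = W r 0 - 1 / R := by ring
        _ ≤ _ := by linarith
    · simp only [hc, if_neg hz, one_mul]
      rw [hW, visitPotential_second_diff_of_ne a R t r hz, neg_div, neg_div, ← sub_eq_add_neg,
        div_div]
      have : 1 / (t : ℝ) ≤ 2 / (R ^ 2 * (G.degree x.1 + 2)) := by
        rw [htr, div_le_div_iff₀ (by positivity) (by positivity)]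
        have : (0 : ℝ) ≤ R ^ 2 := by positivity
        nlinarith
      linarith
  have hFK := hμ.lintegral_prod_le (f := fun s x => F (t - s) x.2) hc0
    (fun s x => hF0 _ (by omega) _) t (fun s hs x => by
      have := hstep (t - (s + 1)) (by omega) x
      rwa [show t - (s + 1) + 1 = t - s by omega] at this)
  have hFt : ∀ z, F (t - t) z = 1 := fun z => by
    simp only [hF]; split_ifs with h
    · refine min_eq_left ?_
      have := hprof z h.le
      simp only [hW, visitPotential, Nat.sub_self, Nat.cast_zero, zero_div]
      linarith
    · rfl
  simp only [hFt, ENNReal.ofReal_one, mul_one, hc, prod_levelWeight, Nat.sub_zero] at hFK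
  have hRHS : ∫⁻ ω, ENNReal.ofReal (F t (ω 0).2) ∂μ ≤ ENNReal.ofReal a * μ Set.univ := by
    rw [← lintegral_const]
    refine lintegral_mono_ae (h0.mono fun ω hω => ENNReal.ofReal_le_ofReal ?_)
    rw [hω]
    refine (hFW t le_rfl 0 (by simp)).trans (le_of_eq ?_)
    simp only [hW, visitPotential]
    rw [div_self ht0.ne']
    norm_num
  have hmeas : Measurable fun ω : ℕ → V × ℤ => ENNReal.ofReal θ ^ visitCount ω t := by
    simp only [← prod_levelWeight]
    exact Finset.measurable_fun_prod _ fun s _ => (measurable_of_countable fun x : V × ℤ =>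
      ENNReal.ofReal (if x.2 = 0 then θ else 1)).comp (measurable_pi_apply s)
  have hmk := mul_meas_ge_le_lintegral (μ := μ) hmeas (ENNReal.ofReal (1 / 2))
  have hsub : {ω : ℕ → V × ℤ | visitCount ω t < l} ⊆
      {ω | ENNReal.ofReal (1 / 2) ≤ ENNReal.ofReal θ ^ visitCount ω t} := by
    intro ω hω
    rw [Set.mem_ofPred_eq, ← ENNReal.ofReal_pow hθ0]
    exact ENNReal.ofReal_le_ofReal (hθl.trans (pow_le_pow_of_le_one hθ0 hθ1 (le_of_lt hω)))
  have htot := (mul_le_mul_right (measure_mono (μ := μ) hsub) (ENNReal.ofReal (1 / 2))).trans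
    (hmk.trans (hFK.trans hRHS))
  calc _ = ENNReal.ofReal 2 * (ENNReal.ofReal (1 / 2) * μ {ω | visitCount ω t < l}) := by
        rw [← mul_assoc, ← ENNReal.ofReal_mul (by positivity)]; norm_num
    _ ≤ ENNReal.ofReal 2 * (ENNReal.ofReal a * μ Set.univ) := by gcongr
    _ = _ := by
      rw [← mul_assoc, ← ENNReal.ofReal_mul (by positivity), ha]
      congr 2
      ring

end Hitting

/-! ### Covered levels disconnect -/

section Disconnection

variable {V : Type*}

theorem cylinderGraph_induce_reachable {G : SimpleGraph V} (hG : G.Connected)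
    {S : Set (V × ℤ)} {I : Set ℤ} [hI : I.OrdConnected] (hIS : ∀ x : V × ℤ, x.2 ∈ I → x ∈ Sᶜ)
    {x y : V × ℤ} (hx : x.2 ∈ I) (hy : y.2 ∈ I) :
    ((cylinderGraph G).induce Sᶜ).Reachable ⟨x, hIS x hx⟩ ⟨y, hIS y hy⟩ := by
  have hvert : ∀ (g : V) (z : ℤ) (hz : z ∈ I) (w : ℤ), z ≤ w → ∀ hw : w ∈ I,
      ((cylinderGraph G).induce Sᶜ).Reachable ⟨(g, z), hIS (g, z) hz⟩ ⟨(g, w), hIS (g, w) hw⟩ := by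
    intro g z hz w hzw
    induction w, hzw using Int.leInduction with
    | base => intro _; exact SimpleGraph.Reachable.refl _
    | succ w hzw ih =>
      intro hw
      have hw' : w ∈ I := hI.out hz hw ⟨hzw, by omega⟩
      refine (ih hw').trans (SimpleGraph.Adj.reachable ?_)
      rw [SimpleGraph.comap_adj]
      exact (cylinderGraph_adj_iff G _ _).2 (Or.inr ⟨rfl, Or.inl rfl⟩)
  have hhor : ∀ (g h : V) (z : ℤ) (hz : z ∈ I),
      ((cylinderGraph G).induce Sᶜ).Reachable ⟨(g, z), hIS (g, z) hz⟩ ⟨(h, z), hIS (h, z) hz⟩ := by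
    intro g h z hz
    obtain ⟨p⟩ := hG.preconnected g h
    induction p with
    | nil => exact SimpleGraph.Reachable.refl _
    | cons hadj p ih =>
      refine SimpleGraph.Reachable.trans (SimpleGraph.Adj.reachable ?_) ih
      rw [SimpleGraph.comap_adj]
      exact (cylinderGraph_adj_iff G _ _).2 (Or.inl ⟨hadj, rfl⟩)
  obtain ⟨g, z⟩ := x
  obtain ⟨h, w⟩ := y
  refine SimpleGraph.Reachable.trans ?_ (hhor g h w hy)
  rcases le_total z w with hzw | hzw
  · exact hvert g z hx w hzw hy
  · exact (hvert g w hy z hzw hx).symm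

theorem disconnects_of_level_subset {G : SimpleGraph V} (hG : G.Connected) {S : Set (V × ℤ)}
    (hS : S.Finite) {u : ℤ} (hu : {x : V × ℤ | x.2 = u} ⊆ S) : Disconnects G S := by
  obtain ⟨g⟩ := hG.nonempty
  obtain ⟨M₀, hM₀⟩ : ∃ M₀ : ℤ, ∀ x ∈ S, |x.2| < M₀ := by
    obtain ⟨b, hb⟩ := (hS.image fun x : V × ℤ => |x.2|).bddAbove
    exact ⟨b + 1, fun x hx => Int.lt_add_one_of_le (hb ⟨x, hx, rfl⟩)⟩
  have hu0 := abs_lt.1 (hM₀ (g, u) (hu rfl))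
  dsimp only at hu0
  filter_upwards [eventually_ge_atTop M₀] with M hM
  have hup : ∀ x : V × ℤ, x.2 ∈ Set.Ici M → x ∈ Sᶜ := fun x hx hxS => by
    have := (abs_lt.1 (hM₀ x hxS)).2
    have hx : M ≤ x.2 := hx
    omega
  have hdown : ∀ x : V × ℤ, x.2 ∈ Set.Iic (-M) → x ∈ Sᶜ := fun x hx hxS => by
    have := (abs_lt.1 (hM₀ x hxS)).1
    have hx : x.2 ≤ -M := hx
    omega
  -- Heights change by at most one per edge, so a path avoiding level u stays on one side of it.
  have hside : ∀ x y : (Sᶜ : Set (V × ℤ)), ((cylinderGraph G).induce Sᶜ).Reachable x y →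
      (u < x.1.2 ↔ u < y.1.2) := by
    rintro x y ⟨p⟩
    induction p with
    | nil => rfl
    | @cons x y w hadj p ih =>
      rw [← ih]
      have hx : x.1.2 ≠ u := fun h => x.2 (hu h)
      have hy : y.1.2 ≠ u := fun h => y.2 (hu h)
      rw [SimpleGraph.comap_adj] at hadj
      rcases (cylinderGraph_adj_iff G _ _).1 hadj with ⟨-, h⟩ | ⟨-, h⟩ <;>
        simp only [Function.Embedding.subtype_apply] at h <;> omega
  refine ⟨SimpleGraph.connectedComponentMk _ ⟨(g, M), hup (g, M) (le_refl M)⟩,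
    SimpleGraph.connectedComponentMk _ ⟨(g, -M), hdown (g, -M) (le_refl (-M))⟩, ?_, ?_, ?_⟩
  · intro h
    have := hside _ _ (SimpleGraph.ConnectedComponent.exact h)
    dsimp only at this
    omega
  · intro x hx
    exact ⟨⟨x, hup x hx⟩, SimpleGraph.ConnectedComponent.sound
      (cylinderGraph_induce_reachable hG hup (y := (g, M)) hx (le_refl M)), rfl⟩
  · intro x hx
    exact ⟨⟨x, hdown x hx⟩, SimpleGraph.ConnectedComponent.sound
      (cylinderGraph_induce_reachable hG hdown (y := (g, -M)) hx (le_refl (-M))), rfl⟩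

theorem disconnectionTime_le_of_level_subset {G : SimpleGraph V} (hG : G.Connected)
    {ω : ℕ → V × ℤ} {n : ℕ} {u : ℤ} (hu : {x : V × ℤ | x.2 = u} ⊆ ω '' Set.Iic n) :
    disconnectionTime G ω ≤ n :=
  iInf₂_le n (disconnects_of_level_subset hG ((Set.finite_Iic n).image ω) hu)

theorem disconnectionTime_le_coverTime {G : SimpleGraph V} (hG : G.Connected) (ω : ℕ → V × ℤ) :
    disconnectionTime G ω ≤ coverTime ω :=
  le_iInf₂ fun _ hn => disconnectionTime_le_of_level_subset hG hn

/-- Trajectories that have not covered level zero by time `t`. -/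
def uncovered (V : Type*) (t : ℕ) : Set (ℕ → V × ℤ) := {ω | ∃ v, ∀ s ≤ t, ω s ≠ (v, 0)}

theorem coverTime_le_of_notMem_uncovered {t : ℕ} {ω : ℕ → V × ℤ} (h : ω ∉ uncovered V t) :
    coverTime ω ≤ t := by
  refine iInf₂_le t fun x hx => ?_
  by_contra hne
  refine h ⟨x.1, fun s hs heq => hne ⟨s, hs, heq.trans ?_⟩⟩
  exact Prod.ext rfl (Eq.symm hx)

theorem disconnectionTime_le_of_recenter_notMem {G : SimpleGraph V} (hG : G.Connected)
    {τ t : ℕ} {ω : ℕ → V × ℤ} (h : recenter τ ω ∉ uncovered V t) :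
    disconnectionTime G ω ≤ (τ + t : ℕ) := by
  refine disconnectionTime_le_of_level_subset hG (u := (ω τ).2) fun x hx => ?_
  by_contra hne
  refine h ⟨x.1, fun s hs heq => hne ⟨τ + s, Nat.add_le_add_left hs τ, ?_⟩⟩
  have h1 := congrArg Prod.fst heq
  have h2 := congrArg Prod.snd heq
  simp only [recenter] at h1 h2
  have hx : x.2 = (ω τ).2 := hx
  exact Prod.ext h1 (by omega)

/-- The level occupied at time `j * t` is not covered during the next `t` steps, for all `j < k`. -/
def failsUntil (V : Type*) (t k : ℕ) : Set (ℕ → V × ℤ) :=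
  {ω | ∀ j < k, recenter (j * t) ω ∈ uncovered V t}

theorem failsUntil_congr {t k : ℕ} {ω ω' : ℕ → V × ℤ} (h : ∀ s ≤ k * t, ω s = ω' s)
    (hω : ω ∈ failsUntil V t k) : ω' ∈ failsUntil V t k := by
  intro j hj
  obtain ⟨v, hv⟩ := hω j hj
  refine ⟨v, fun s hs => ?_⟩
  have hjk : j * t + t ≤ k * t := by
    rw [← Nat.succ_mul]; exact Nat.mul_le_mul_right t hj
  have := hv s hs
  simp only [recenter] at this ⊢
  rwa [← h (j * t + s) (by omega), ← h (j * t) (by omega)]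

/-- If block k is the first success, disconnection occurs by time (k + 1)t, and exactly the k + 1
terms 0 to k of the series contribute t. Without success the series is infinite. -/
theorem disconnectionTime_le_tsum {G : SimpleGraph V} (hG : G.Connected) {t : ℕ} (ht : 0 < t)
    (ω : ℕ → V × ℤ) : (disconnectionTime G ω : ℝ≥0∞) ≤
      ∑' k, (failsUntil V t k).indicator (fun _ => (t : ℝ≥0∞)) ω := by
  classical
  by_cases h : ∃ k, recenter (k * t) ω ∉ uncovered V t
  · have hspec := Nat.find_spec h
    have hmin : ∀ j < Nat.find h, recenter (j * t) ω ∈ uncovered V t :=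
      fun j hj => not_not.1 (Nat.find_min h hj)
    set k := Nat.find h
    have hT : (disconnectionTime G ω : ℝ≥0∞) ≤ ((k * t + t : ℕ) : ℝ≥0∞) := by
      have := disconnectionTime_le_of_recenter_notMem hG hspec
      exact_mod_cast ENat.toENNReal_le.2 this
    refine hT.trans (le_trans (le_of_eq ?_) (ENNReal.sum_le_tsum (Finset.range (k + 1))))
    rw [Finset.sum_congr rfl fun j hj => Set.indicator_of_mem
      (show ω ∈ failsUntil V t j from fun i hi => hmin i (by
        have := Finset.mem_range.1 hj; omega)) _]
    rw [Finset.sum_const, Finset.card_range, nsmul_eq_mul]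
    push_cast
    ring
  · push Not at h
    have : ∀ k, (failsUntil V t k).indicator (fun _ => (t : ℝ≥0∞)) ω = t :=
      fun k => Set.indicator_of_mem (show ω ∈ failsUntil V t k from fun j _ => h j) _
    simp only [this]
    rw [ENNReal.tsum_const_eq_top_of_ne_zero (by exact_mod_cast ht.ne')]
    exact le_top

theorem measurableSet_uncovered [Fintype V] [MeasurableSpace V] [DiscreteMeasurableSpace V]
    (t : ℕ) : MeasurableSet (uncovered V t) := by
  have : uncovered V t = ⋃ v : V, ⋂ s ∈ Set.Iic t, (fun ω : ℕ → V × ℤ => ω s) ⁻¹' {(v, 0)}ᶜ := by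
    ext ω
    simp [uncovered]
  rw [this]
  exact MeasurableSet.iUnion fun v => MeasurableSet.biInter (Set.to_countable _) fun s _ =>
    measurable_pi_apply s (measurableSet_singleton _).compl

end Disconnection

/-! ### Covering level zero in time of order n² (log n)⁴ -/

section Covering

theorem measure_uncovered_le {V : Type*} [Fintype V] {G : SimpleGraph V} [DecidableRel G.Adj]
    [MeasurableSpace V] [DiscreteMeasurableSpace V]
    (hG : G.Connected) {μ : Measure (ℕ → V × ℤ)} (hμ : IsWalk G μ)
    (h0 : ∀ᵐ ω ∂μ, (ω 0).2 = 0) {l R : ℕ} (hl : 0 < l) (hR : 0 < R) :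
    μ (uncovered V ((G.maxDegree + 2) * R ^ 2)) ≤ ENNReal.ofReal
      (12 * l / R + Fintype.card V * (2 * (1 - 1 / (2 * visitBound G)) ^ l)) * μ Set.univ := by
  have : Nonempty V := hG.nonempty
  set t := (G.maxDegree + 2) * R ^ 2
  have hsub : uncovered V t ⊆ {ω | visitCount ω t < l} ∪
      ⋃ y : V, {ω | (∀ s < t, ω s ≠ (y, 0)) ∧ l ≤ visitCount ω t} := by
    rintro ω ⟨y, hy⟩
    rcases lt_or_ge (visitCount ω t) l with h | h
    · exact Or.inl h
    · exact Or.inr (Set.mem_iUnion.2 ⟨y, fun s hs => hy s hs.le, h⟩)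
  have hq : 0 ≤ 1 - 1 / (2 * visitBound G) := by
    have hD : 1 ≤ visitBound G := visitBound_ge_one
    have : 1 / (2 * visitBound G) ≤ 1 := by rw [div_le_one (by positivity)]; linarith
    linarith
  refine (measure_mono hsub).trans ((measure_union_le _ _).trans ?_)
  rw [ENNReal.ofReal_add (by positivity) (by positivity), add_mul]
  refine add_le_add (measure_few_visits_le hμ h0 hl hR) ?_
  refine (measure_iUnion_fintype_le μ _).trans ?_
  refine (Finset.sum_le_sum fun y _ => measure_many_visits_not_hit_le y hG hμ t l).trans ?_
  rw [Finset.sum_const, Finset.card_univ, nsmul_eq_mul,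
    ENNReal.ofReal_mul (p := Fintype.card V) (by positivity), ENNReal.ofReal_natCast, mul_assoc]

theorem exists_time_measure_uncovered_le (d₀ : ℕ) {η : ℝ} (hη : 0 < η) :
    ∃ C : ℝ, 0 < C ∧ ∃ N : ℕ, ∀ (V : Type*) [Fintype V] [MeasurableSpace V]
      [DiscreteMeasurableSpace V] (G : SimpleGraph V) [DecidableRel G.Adj],
      G.Connected → G.maxDegree ≤ d₀ → N ≤ Fintype.card V →
        ∃ t : ℕ, 0 < t ∧
          (t : ℝ) ≤ C * ((Fintype.card V : ℝ) ^ 2 * Real.log (Fintype.card V) ^ 4) ∧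
          ∀ μ : Measure (ℕ → V × ℤ), IsWalk G μ → (∀ᵐ ω ∂μ, (ω 0).2 = 0) →
            μ (uncovered V t) ≤ ENNReal.ofReal η * μ Set.univ := by
  set k : ℝ := d₀ + 2 with hk
  have hk0 : 2 ≤ k := by have : (0 : ℝ) ≤ d₀ := by positivity
                         linarith
  -- Here 161 = 4 · 40 + 1, with 40 from the bound on D and 1 from rounding l up. The threshold 3
  -- gives log n ≥ 1, and 4/η makes the union bound 2/n at most η/2.
  refine ⟨k * ((24 / η) * (161 * k) + 1) ^ 2, by positivity, max 3 ⌈4 / η⌉₊, ?_⟩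
  intro V _ _ _ G _ hG hdeg hN
  have : Nonempty V := hG.nonempty
  set n := Fintype.card V
  have hn3 : 3 ≤ n := (le_max_left _ _).trans hN
  have hn3r : (3 : ℝ) ≤ n := by exact_mod_cast hn3
  have hnη : 4 / η ≤ n := (Nat.le_ceil _).trans (by exact_mod_cast (le_max_right _ _).trans hN)
  have hlog : 1 ≤ Real.log n := by
    rw [Real.le_log_iff_exp_le (by positivity)]
    exact (Real.exp_one_lt_d9.le.trans (by norm_num)).trans hn3r
  set L := Real.log n
  set D := visitBound G with hD
  have hD1 : 1 ≤ D := visitBound_ge_one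
  have hdegr : (G.maxDegree : ℝ) + 2 ≤ k := by
    rw [hk]; gcongr
  have hDle : D ≤ 40 * (k * (n * L)) := by
    rw [hD, visitBound]
    calc 2 * ((12 + 8 * L) * ((G.maxDegree + 2) * n)) ≤ 2 * ((20 * L) * (k * n)) := by
          gcongr; linarith
      _ = _ := by ring
  -- This makes (1 - 1/(2D))^l ≤ exp(-2 log n) = 1/n².
  set l := ⌈4 * D * L⌉₊
  have hl0 : 0 < l := Nat.ceil_pos.2 (by positivity)
  have hl1 : 4 * D * L ≤ l := Nat.le_ceil _
  have hnL : 1 ≤ n * L ^ 2 := by nlinarith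
  have hl2 : (l : ℝ) ≤ 161 * k * (n * L ^ 2) := by
    refine (Nat.ceil_lt_add_one (by positivity)).le.trans ?_
    calc 4 * D * L + 1 ≤ 4 * (40 * (k * (n * L))) * L + k * (n * L ^ 2) := by
          gcongr
          nlinarith
      _ = _ := by ring
  set R := ⌈24 / η * l⌉₊
  have hlr : (0 : ℝ) < l := by exact_mod_cast hl0
  have hR0 : 0 < R := Nat.ceil_pos.2 (by positivity)
  have hRr : (0 : ℝ) < R := by exact_mod_cast hR0
  have hR1 : 24 / η * l ≤ R := Nat.le_ceil _
  have hR2 : (R : ℝ) ≤ (24 / η * (161 * k) + 1) * (n * L ^ 2) := by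
    refine (Nat.ceil_lt_add_one (by positivity)).le.trans ?_
    calc 24 / η * l + 1 ≤ 24 / η * (161 * k * (n * L ^ 2)) + n * L ^ 2 := by gcongr
      _ = _ := by ring
  refine ⟨(G.maxDegree + 2) * R ^ 2, by positivity, ?_, ?_⟩
  · push_cast
    calc ((G.maxDegree : ℝ) + 2) * R ^ 2
        ≤ k * ((24 / η * (161 * k) + 1) * (n * L ^ 2)) ^ 2 := by gcongr
      _ = _ := by ring
  · intro μ hμ h0
    refine (measure_uncovered_le hG hμ h0 hl0 hR0).trans ?_
    gcongr
    have h1 : 12 * l / R ≤ η / 2 := by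
      rw [div_le_iff₀ hRr]
      have : η * (24 / η * l) ≤ η * R := by gcongr
      have e : η * (24 / η * l) = 24 * l := by field_simp
      linarith
    have h2 : (1 - 1 / (2 * D)) ^ l ≤ 1 / (n : ℝ) ^ 2 := by
      have hq : 0 ≤ 1 - 1 / (2 * D) := by
        have : 1 / (2 * D) ≤ 1 := by rw [div_le_one (by positivity)]; linarith
        linarith
      calc (1 - 1 / (2 * D)) ^ l ≤ Real.exp (-(1 / (2 * D))) ^ l :=
            pow_le_pow_left₀ hq (Real.one_sub_le_exp_neg _) l
        _ = Real.exp (-(l / (2 * D))) := by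
            rw [← Real.exp_nat_mul]; congr 1; ring
        _ ≤ Real.exp (-(2 * L)) := by
            gcongr
            rw [le_div_iff₀ (by positivity)]
            linarith
        _ = 1 / (n : ℝ) ^ 2 := by
            rw [Real.exp_neg, mul_comm, Real.exp_mul, Real.exp_log (by positivity), one_div]
            norm_num
    have h3 : (n : ℝ) * (2 * (1 - 1 / (2 * D)) ^ l) ≤ η / 2 := by
      calc (n : ℝ) * (2 * (1 - 1 / (2 * D)) ^ l) ≤ n * (2 * (1 / (n : ℝ) ^ 2)) := by gcongr
        _ = 2 / n := by field_simp
        _ ≤ η / 2 := by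
          rw [div_le_iff₀ (by positivity)]
          rw [div_le_iff₀ hη] at hnη
          linarith
    linarith

end Covering

/-! ### Independent attempts and the expected disconnection time -/

section Restart

variable {V : Type*} [Fintype V] [MeasurableSpace V] [DiscreteMeasurableSpace V]

/-- An event A decided by time τ is a preimage under restriction to [0, τ], so the uniform covering
bound applies to the recentered walk restricted to A. -/
theorem measure_inter_recenter_le {G : SimpleGraph V} {μ : Measure (ℕ → V × ℤ)} (hμ : IsWalk G μ)
    {t : ℕ} {η : ℝ≥0∞} (ht : ∀ ν : Measure (ℕ → V × ℤ), IsWalk G ν → (∀ᵐ ω ∂ν, (ω 0).2 = 0) →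
      ν (uncovered V t) ≤ η * ν Set.univ) (τ : ℕ) (A : Set (ℕ → V × ℤ))
    (hA : ∀ ω ω' : ℕ → V × ℤ, (∀ s ≤ τ, ω s = ω' s) → ω ∈ A → ω' ∈ A) :
    μ (A ∩ recenter τ ⁻¹' uncovered V t) ≤ η * μ A := by
  have hpre : Preorder.frestrictLe (π := fun _ => V × ℤ) τ ⁻¹'
      (Preorder.frestrictLe (π := fun _ => V × ℤ) τ '' A) = A := by
    refine Set.Subset.antisymm ?_ (Set.subset_preimage_image _ _)
    rintro ω ⟨ω', hω', heq⟩
    exact hA ω' ω (fun s hs => congrFun heq ⟨s, Finset.mem_Iic.2 hs⟩) hω'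
  have hw := hμ.map_recenter τ (Preorder.frestrictLe (π := fun _ => V × ℤ) τ '' A)
  rw [hpre] at hw
  have h0 : ∀ᵐ ω ∂((μ.restrict A).map (recenter τ)), (ω 0).2 = 0 := by
    have hm : MeasurableSet {ω : ℕ → V × ℤ | (ω 0).2 = 0} :=
      measurableSet_eq_fun (by fun_prop) measurable_const
    rw [ae_map_iff (measurable_recenter τ).aemeasurable hm]
    exact Eventually.of_forall fun ω => by simp [recenter]
  have h := ht _ hw h0
  rw [Measure.map_apply (measurable_recenter τ) (measurableSet_uncovered t),
    Measure.map_apply (measurable_recenter τ) MeasurableSet.univ, Set.preimage_univ,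
    Measure.restrict_apply_univ,
    Measure.restrict_apply (measurable_recenter τ (measurableSet_uncovered t)), Set.inter_comm] at h
  exact h

theorem measurableSet_failsUntil (t k : ℕ) : MeasurableSet (failsUntil V t k) := by
  have : failsUntil V t k = ⋂ j ∈ Set.Iio k, recenter (j * t) ⁻¹' uncovered V t := by
    ext ω
    simp [failsUntil]
  rw [this]
  exact MeasurableSet.biInter (Set.to_countable _) fun j _ =>
    measurable_recenter _ (measurableSet_uncovered t)

theorem measure_failsUntil_le {G : SimpleGraph V} {μ : Measure (ℕ → V × ℤ)}
    [IsProbabilityMeasure μ] (hμ : IsWalk G μ) {t : ℕ} {η : ℝ≥0∞}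
    (ht : ∀ ν : Measure (ℕ → V × ℤ), IsWalk G ν → (∀ᵐ ω ∂ν, (ω 0).2 = 0) →
      ν (uncovered V t) ≤ η * ν Set.univ) (k : ℕ) : μ (failsUntil V t k) ≤ η ^ k := by
  induction k with
  | zero => simpa using prob_le_one
  | succ k ih =>
    have hsub : failsUntil V t (k + 1) ⊆
        failsUntil V t k ∩ recenter (k * t) ⁻¹' uncovered V t :=
      fun ω hω => ⟨fun j hj => hω j (by omega), hω k (by omega)⟩
    refine (measure_mono hsub).trans ((measure_inter_recenter_le hμ ht (k * t) _
      fun ω ω' h => failsUntil_congr h).trans ?_)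
    rw [pow_succ']
    gcongr

theorem lintegral_disconnectionTime_le {G : SimpleGraph V} (hG : G.Connected)
    {μ : Measure (ℕ → V × ℤ)} [IsProbabilityMeasure μ] (hμ : IsWalk G μ) {t : ℕ} (ht0 : 0 < t)
    {η : ℝ≥0∞} (hη : η ≤ 2⁻¹)
    (ht : ∀ ν : Measure (ℕ → V × ℤ), IsWalk G ν → (∀ᵐ ω ∂ν, (ω 0).2 = 0) →
      ν (uncovered V t) ≤ η * ν Set.univ) :
    ∫⁻ ω, (disconnectionTime G ω : ℝ≥0∞) ∂μ ≤ 2 * t := by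
  refine (lintegral_mono fun ω => disconnectionTime_le_tsum hG ht0 ω).trans ?_
  rw [lintegral_tsum fun k =>
    (measurable_const.indicator (measurableSet_failsUntil t k)).aemeasurable]
  calc ∑' k, ∫⁻ ω, (failsUntil V t k).indicator (fun _ => (t : ℝ≥0∞)) ω ∂μ
      ≤ ∑' k : ℕ, (t : ℝ≥0∞) * 2⁻¹ ^ k := by
        refine ENNReal.tsum_le_tsum fun k => ?_
        rw [lintegral_indicator_const (measurableSet_failsUntil t k)]
        gcongr
        exact (measure_failsUntil_le hμ ht k).trans (by gcongr)
    _ = 2 * t := by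
        rw [ENNReal.tsum_mul_left, ENNReal.tsum_geometric, ENNReal.one_sub_inv_two, inv_inv,
          mul_comm]

theorem one_sub_le_measureReal {Ω : Type*} [MeasurableSpace Ω] {μ : Measure Ω}
    [IsProbabilityMeasure μ] {A S : Set Ω} (hA : MeasurableSet A) {η δ : ℝ} (hη : 0 ≤ η)
    (hηδ : η ≤ δ) (h : μ A ≤ ENNReal.ofReal η) (hS : Aᶜ ⊆ S) : 1 - δ ≤ μ.real S := by
  have h1 : μ.real A ≤ η := ENNReal.toReal_le_of_le_ofReal hη h
  have h2 := probReal_compl_eq_one_sub (μ := μ) hA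
  have h3 : μ.real Aᶜ ≤ μ.real S := measureReal_mono hS
  linarith

theorem exists_log_rpow_ge {ε : ℝ} (hε : 0 < ε) (C : ℝ) :
    ∃ N : ℕ, 2 ≤ N ∧ ∀ n : ℕ, N ≤ n → C ≤ Real.log n ^ ε := by
  have h : Tendsto (fun n : ℕ => Real.log n ^ ε) atTop atTop :=
    (tendsto_rpow_atTop hε).comp (Real.tendsto_log_atTop.comp tendsto_natCast_atTop_atTop)
  obtain ⟨N, hN⟩ := eventually_atTop.1 (h.eventually_ge_atTop C)
  exact ⟨max 2 N, le_max_left _ _, fun n hn => hN n ((le_max_right _ _).trans hn)⟩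

end Restart

end DiscreteCylinder

/-! ### The theorem -/

open DiscreteCylinder in
theorem theorem1p2 (d₀ : ℕ) (ε : ℝ) (hε : 0 < ε) (δ : ℝ) (hδ : 0 < δ) :
    ∃ N : ℕ, ∀ (V : Type*) [Fintype V] [MeasurableSpace V] [DiscreteMeasurableSpace V]
      (G : SimpleGraph V) [DecidableRel G.Adj],
      G.Connected → G.maxDegree ≤ d₀ → N ≤ Fintype.card V →
        (∀ g : V, 1 - δ ≤ (walkLaw G (g, 0)).real
          {ω | disconnectionTime G ω ≤ coverTime ω ∧
            (coverTime ω : ℝ≥0∞) ≤ ENNReal.ofReal (timeScale V ε)}) ∧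
        (∀ x : V × ℤ, 1 - δ ≤ (walkLaw G x).real
          {ω | (disconnectionTime G ω : ℝ≥0∞) ≤ ENNReal.ofReal (timeScale V ε)}) ∧
        (∀ x : V × ℤ, ∫⁻ ω, (disconnectionTime G ω : ℝ≥0∞) ∂(walkLaw G x) ≤
          ENNReal.ofReal (δ * timeScale V ε)) := by
  -- The bound δ serves the two probabilities; 1/2 makes the series over failed blocks sum to at
  -- most 2t.
  set η := min δ (1 / 2) with hη
  have hη0 : 0 < η := lt_min hδ (by norm_num)
  obtain ⟨C, hC, N₁, hN₁⟩ := exists_time_measure_uncovered_le d₀ hη0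
  obtain ⟨N₂, h2N₂, hN₂⟩ := exists_log_rpow_ge hε (max C (2 * C / δ))
  refine ⟨max N₁ N₂, ?_⟩
  intro V _ _ _ G _ hG hdeg hN
  obtain ⟨t, ht0, htle, ht⟩ := hN₁ V G hG hdeg ((le_max_left _ _).trans hN)
  have hn2 : 2 ≤ Fintype.card V := h2N₂.trans ((le_max_right _ _).trans hN)
  have hlogε := hN₂ _ ((le_max_right _ _).trans hN)
  have hlog : 0 < Real.log (Fintype.card V) :=
    Real.log_pos (by exact_mod_cast lt_of_lt_of_le one_lt_two hn2)
  have hscale : timeScale V ε = (Fintype.card V : ℝ) ^ 2 * Real.log (Fintype.card V) ^ 4 *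
      Real.log (Fintype.card V) ^ ε := by
    rw [timeScale, Real.rpow_add hlog, mul_assoc]
    norm_cast
  set X := (Fintype.card V : ℝ) ^ 2 * Real.log (Fintype.card V) ^ 4
  have hX : 0 ≤ X := by positivity
  have ht1 : (t : ℝ) ≤ timeScale V ε := by
    rw [hscale, mul_comm X]
    exact htle.trans (by gcongr; exact (le_max_left _ _).trans hlogε)
  have ht2 : 2 * (t : ℝ) ≤ δ * timeScale V ε := by
    rw [hscale]
    calc 2 * (t : ℝ) ≤ 2 * (C * X) := by gcongr
      _ = δ * (X * (2 * C / δ)) := by field_simp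
      _ ≤ _ := by gcongr; exact (le_max_right _ _).trans hlogε
  have htE : (t : ℝ≥0∞) ≤ ENNReal.ofReal (timeScale V ε) := by
    rw [← ENNReal.ofReal_natCast]
    exact ENNReal.ofReal_le_ofReal ht1
  refine ⟨fun g => ?_, fun x => ?_, fun x => ?_⟩
  · refine one_sub_le_measureReal (measurableSet_uncovered t) hη0.le (min_le_left _ _) ?_
      fun ω hω => ⟨disconnectionTime_le_coverTime hG ω, le_trans ?_ htE⟩
    · have := ht _ (isWalk_walkLaw G (g, 0)) ((walkLaw_ae_zero G (g, 0)).mono fun ω h => by rw [h])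
      rwa [measure_univ, mul_one] at this
    · exact_mod_cast ENat.toENNReal_le.2 (coverTime_le_of_notMem_uncovered hω)
  -- Recentering at time 0 moves an arbitrary starting level to level zero.
  · refine one_sub_le_measureReal (measurable_recenter 0 (measurableSet_uncovered t)) hη0.le
      (min_le_left _ _) ?_ fun ω hω => le_trans ?_ htE
    · have := measure_inter_recenter_le (isWalk_walkLaw G x) ht 0 Set.univ
        fun _ _ _ _ => Set.mem_univ _
      rwa [measure_univ, mul_one, Set.univ_inter] at this
    · have := disconnectionTime_le_of_recenter_notMem hG hω
      rw [zero_add] at this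
      exact_mod_cast ENat.toENNReal_le.2 this
  · have hη2 : ENNReal.ofReal η ≤ 2⁻¹ := by
      rw [← ENNReal.ofReal_ofNat 2, ← ENNReal.ofReal_inv_of_pos (by norm_num)]
      exact ENNReal.ofReal_le_ofReal ((min_le_right _ _).trans (by norm_num))
    refine (lintegral_disconnectionTime_le hG (isWalk_walkLaw G x) ht0 hη2 ht).trans ?_
    refine le_trans (le_of_eq ?_) (ENNReal.ofReal_le_ofReal ht2)
    rw [ENNReal.ofReal_mul (by norm_num), ENNReal.ofReal_natCast, ENNReal.ofReal_ofNat]
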